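/- For a finite sequence of positive integers $\mathbf a=(a_1,\dots,a_r)$ with $r\ge 1$ put $$\sigma(a_1,\dots,a_r)=\sum_{n_1>\cdots>n_r>0}\binom{2n_1}{n_1}^{-1}n_1^{-a_1}\cdots n_r^{-a_r},$$ the sum being over all strictly decreasing $r$-tuples of positive integers. Let $\zeta$ be the Riemann zeta function and $L(s,\chi)$ the Dirichlet $L$-function of the unique non-principal Dirichlet character $\chi$ modulo $3$. Then all the series $\sigma$ below converge, and the following hold. (i) For all integers $a\ge 1$, $b\ge 0$, with $k=2a+2b+1$, $$\begin{aligned}\sigma(\underbrace{2,\dots,2}_a,1,\underbrace{2,\dots,2}_b)={}&\sum_{r=a}^{a+b}\binom{2r}{2a-1}\frac{(\pi/3)^{k-1-2r}}{(k-1-2r)!}(-1)^r(1-3^{-2r})\,\zeta(2r+1)\\&+\sum_{r=a}^{a+b}\binom{2r-1}{2a-1}\frac{(\pi/3)^{k-2r}}{(k-2r)!}(-1)^r\sqrt3\,L(2r,\chi)\\&-\sum_{r=b+1}^{a+b}\binom{2r}{2b+1}\frac{(\pi/3)^{k-1-2r}}{(k-1-2r)!}(-1)^r\,2(1-2^{-2r})\,\zeta(2r+1).\end{aligned}$$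 (ii) For all integers $a\ge 0$, $b\ge 0$, with $k=2a+2b+3$, $$\begin{aligned}\sigma(\underbrace{2,\dots,2}_a,3,\underbrace{2,\dots,2}_b)={}&-\sum_{r=\max(a,1)}^{a+b+1}\binom{2r}{2a}\frac{(\pi/3)^{k-1-2r}}{(k-1-2r)!}(-1)^r(1-2^{-2r})(1-3^{-2r})\,\zeta(2r+1)\\&-\sum_{r=a+1}^{a+b+1}\binom{2r-1}{2a}\frac{(\pi/3)^{k-2r}}{(k-2r)!}(-1)^r\sqrt3\,(1+2^{1-2r})\,L(2r,\chi)\\&+\sum_{r=b+1}^{a+b+1}\binom{2r}{2b+2}\frac{(\pi/3)^{k-1-2r}}{(k-1-2r)!}\,2(-1)^r\,\zeta(2r+1).\end{aligned}$$ -/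

import Mathlib

/-- Strictly decreasing sequences `n₁ > n₂ > ⋯ > n_r > 0` of positive integers. -/
def decreasingTuples (r : ℕ) : Set (Fin r → ℕ) :=
  {n | StrictAnti n ∧ ∀ i, 0 < n i}

/-- The general term `binom(2n₁, n₁)⁻¹ n₁^(-a₁) ⋯ n_r^(-a_r)` of the multiple Apéry-like sum
attached to `a = (a₁, …, a_r)`; for `r = 0` it is `1`. -/
noncomputable def aperyTerm (a : List ℕ) (n : Fin a.length → ℕ) : ℝ :=
  (if h : 0 < a.length then (((2 * n ⟨0, h⟩).choose (n ⟨0, h⟩) : ℕ) : ℝ)⁻¹ else 1) *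
    ∏ i, ((n i : ℝ) ^ a.get i)⁻¹

/-- The series defining `σ(a)` converges (absolutely). -/
def AperySummable (a : List ℕ) : Prop :=
  Summable fun n : decreasingTuples a.length => aperyTerm a n

/-- The multiple Apéry-like sum
`σ(a) = ∑_{n₁ > ⋯ > n_r > 0} binom(2n₁, n₁)⁻¹ n₁^(-a₁) ⋯ n_r^(-a_r)`. -/
noncomputable def aperySum (a : List ℕ) : ℝ :=
  ∑' n : decreasingTuples a.length, aperyTerm a n

/-- The sequence `(2, …, 2, c, 2, …, 2)` with `a` twos before `c` and `b` twos after it. -/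
def twosAround (a c b : ℕ) : List ℕ :=
  List.replicate a 2 ++ c :: List.replicate b 2

/-! Replace `binom(2n₁, n₁)⁻¹` by `(2 sin (t/2))^(2n₁) / binom(2n₁, n₁)`; the resulting generating
series `aperySeries` returns the Apéry-like sum at `t = π/3`, where `2 sin (t/2) = 1`. Prepending an
index 1 multiplies the integral of the series by `tan (t/2)`, and raising the leading index by one
integrates it against `cot (t/2)` (`aperySeries_one_cons`, `aperySeries_succ_cons`). Hence tan and
cot cancel for an index 2, which is plain double integration. A block of `b` twos gives
`t^(2b)/(2b)!`, and a single 1 or 3 among the twos leaves exactly one factor tan or cot. With `T =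
π/3`, each sum becomes one integral of `(T - s)^p/p! * s^q/q!` against `tan (s/2)` or `cot (s/2)`
(`aperySum_twosAround_one`, `aperySum_twosAround_three`). Up to this point everything is nonnegative
and is computed in `ℝ≥0∞`, so interchanges are free and convergence comes with the value.

In the sense of Abel, `cot (s/2) = 2 ∑ sin (n s)` and `tan (s/2) = -2 ∑ (-1)^n sin (n s)`.
Integrating by parts term by term (`integral_betaKernel_mul_cexp`) and letting the Abel parameter
tend to 1 yields finite sums of polylogarithms at `exp (iπ/3)` and `1` for cot, and at their
negatives for tan (`integral_betaKernel_mul_cot`, `integral_betaKernel_mul_tan`). Taking imaginary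
parts keeps the real part in odd order and the imaginary part in even order (`polylogSum_im`). Since
`-exp (iπ/3)` is a primitive cube root of unity, these parts are multiples of `ζ(2r+1)` and `√3
L(2r, χ)`, with Euler factors at 2 and 3. -/

open scoped ENNReal
open MeasureTheory Set Filter Topology

/-! ### Sums over decreasing tuples, grouped by the largest entry -/

/-- The total weight of the tuples `n₁ > ⋯ > n_r > 0` with `n₁ = m`, where a tuple has weight
`n₁^(-a₁) ⋯ n_r^(-a_r)`; the empty tuple is regarded as having `n₁ = 0`. -/
noncomputable def headWeight : List ℕ → ℕ → ℝ
  | [], m => if m = 0 then 1 else 0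
  | x :: a, m => if m = 0 then 0 else ((m : ℝ) ^ x)⁻¹ * ∑ j ∈ Finset.range m, headWeight a j

lemma headWeight_nonneg (a : List ℕ) (m : ℕ) : 0 ≤ headWeight a m := by
  induction a generalizing m with
  | nil => simp only [headWeight]; split_ifs <;> norm_num
  | cons x a ih =>
    simp only [headWeight]
    split_ifs
    · exact le_rfl
    · exact mul_nonneg (by positivity) (Finset.sum_nonneg fun j _ => ih j)

/-- The first entry of a tuple, `0` for the empty tuple. -/
def headOrZero {r : ℕ} (n : Fin r → ℕ) : ℕ := if h : 0 < r then n ⟨0, h⟩ else 0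

/-- The convention that the empty tuple has head `0` lets one inequality express both the strict
decrease and, for an empty tail, the positivity of `m`. -/
lemma cons_mem_decreasingTuples {r : ℕ} (m : ℕ) (v : Fin r → ℕ) :
    (Fin.cons m v : Fin (r + 1) → ℕ) ∈ decreasingTuples (r + 1) ↔
      v ∈ decreasingTuples r ∧ headOrZero v < m := by
  simp only [decreasingTuples, Set.mem_ofPred_eq, headOrZero]
  constructor
  · rintro ⟨h1, h2⟩
    refine ⟨⟨fun i j hij => ?_, fun i => ?_⟩, ?_⟩
    · simpa using h1 (Fin.succ_lt_succ_iff.2 hij)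
    · simpa using h2 i.succ
    · split_ifs with h
      · have h4 := h1 (Fin.succ_pos (⟨0, h⟩ : Fin r))
        rwa [Fin.cons_succ, Fin.cons_zero] at h4
      · simpa using h2 0
  · rintro ⟨⟨h1, h2⟩, h3⟩
    refine ⟨fun i j hij => ?_, fun i => ?_⟩
    · induction j using Fin.cases with
      | zero => exact absurd hij (Fin.not_lt_zero i)
      | succ j =>
        have hr : 0 < r := j.pos
        rw [dif_pos hr] at h3
        induction i using Fin.cases with
        | zero =>
          simp only [Fin.cons_succ, Fin.cons_zero]
          exact lt_of_le_of_lt (h1.antitone (Fin.le_def.2 (Nat.zero_le _))) h3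
        | succ i => simpa using h1 (Fin.succ_lt_succ_iff.1 hij)
    · induction i using Fin.cases with
      | zero => simpa using lt_of_le_of_lt (Nat.zero_le _) h3
      | succ i => simpa using h2 i

/-- The test function `g` stays arbitrary so that the induction can feed in the indicator of `j <
m`, the constraint that a new first entry `m` puts on the tail. -/
lemma tsum_decreasingTuples (a : List ℕ) (g : ℕ → ℝ≥0∞) :
    ∑' n : decreasingTuples a.length,
        g (headOrZero n.1) * ENNReal.ofReal (∏ i, ((n.1 i : ℝ) ^ a.get i)⁻¹) =
      ∑' m, g m * ENNReal.ofReal (headWeight a m) := by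
  classical
  induction a generalizing g with
  | nil =>
    have : Unique (decreasingTuples ([] : List ℕ).length) :=
      { default := ⟨Fin.elim0, fun i => i.elim0, fun i => i.elim0⟩
        uniq := fun x => Subtype.ext (funext fun i => i.elim0) }
    rw [tsum_eq_single default (fun m hm => absurd (Subsingleton.elim _ _) hm),
      tsum_eq_single 0 (by intro m hm; simp [headWeight, hm])]
    simp [headWeight, headOrZero]
  | cons x a ih =>
    rw [tsum_subtype (decreasingTuples (x :: a).length) (fun n => g (headOrZero n) *
      ENNReal.ofReal (∏ i, ((n i : ℝ) ^ (x :: a).get i)⁻¹))]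
    change ∑' n : Fin (a.length + 1) → ℕ, _ = _
    rw [← (Fin.consEquiv (fun _ : Fin (a.length + 1) => ℕ)).tsum_eq, ENNReal.tsum_prod']
    refine tsum_congr fun m => ?_
    have key := ih (fun j => if j < m then 1 else 0)
    rw [tsum_subtype (decreasingTuples a.length) (fun n => (if headOrZero n < m then 1 else 0) *
      ENNReal.ofReal (∏ i, ((n i : ℝ) ^ a.get i)⁻¹))] at key
    have hfin : ∑' j, (if j < m then 1 else 0) * ENNReal.ofReal (headWeight a j) =
        ENNReal.ofReal (∑ j ∈ Finset.range m, headWeight a j) := by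
      rw [ENNReal.ofReal_sum_of_nonneg fun j _ => headWeight_nonneg a j,
        tsum_eq_sum (s := Finset.range m)]
      · refine Finset.sum_congr rfl fun j hj => ?_
        rw [if_pos (Finset.mem_range.1 hj), one_mul]
      · intro j hj
        rw [if_neg (by simpa using hj), zero_mul]
    rw [hfin] at key
    have hm : g m * ENNReal.ofReal (headWeight (x :: a) m) =
        (g m * ENNReal.ofReal (((m : ℝ) ^ x)⁻¹)) *
          ENNReal.ofReal (∑ j ∈ Finset.range m, headWeight a j) := by
      simp only [headWeight]
      split_ifs with h
      · subst h; simp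
      · rw [ENNReal.ofReal_mul (by positivity), mul_assoc]
    rw [hm, ← key, ← ENNReal.tsum_mul_left]
    refine tsum_congr fun v => ?_
    have e : (Fin.consEquiv (fun _ : Fin (a.length + 1) => ℕ)) (m, v) = Fin.cons m v := rfl
    rw [e, Set.indicator_apply, Set.indicator_apply]
    have hmem : (Fin.cons m v : Fin (x :: a).length → ℕ) ∈ decreasingTuples (x :: a).length ↔
        v ∈ decreasingTuples a.length ∧ headOrZero v < m := cons_mem_decreasingTuples m v
    by_cases h1 : v ∈ decreasingTuples a.length
    · by_cases h2 : headOrZero v < m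
      · rw [if_pos (hmem.2 ⟨h1, h2⟩), if_pos h1, if_pos h2, one_mul]
        have h3 : headOrZero (Fin.cons m v : Fin (a.length + 1) → ℕ) = m := by
          simp [headOrZero]
        have h4 : ∏ i, (((Fin.cons m v : Fin (a.length + 1) → ℕ) i : ℝ) ^ (x :: a).get i)⁻¹ =
            ((m : ℝ) ^ x)⁻¹ * ∏ i, ((v i : ℝ) ^ a.get i)⁻¹ := by
          rw [Fin.prod_univ_succ]; simp
        rw [h3]
        erw [h4]
        rw [ENNReal.ofReal_mul (by positivity), mul_assoc]
      · rw [if_neg fun h => h2 (hmem.1 h).2, if_pos h1, if_neg h2, zero_mul, mul_zero]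
    · rw [if_neg fun h => h1 (hmem.1 h).1, if_neg h1, mul_zero]

lemma aperyTerm_eq (a : List ℕ) (n : Fin a.length → ℕ) :
    aperyTerm a n = ((headOrZero n).centralBinom : ℝ)⁻¹ * ∏ i, ((n i : ℝ) ^ a.get i)⁻¹ := by
  unfold aperyTerm headOrZero
  split_ifs <;> simp [Nat.centralBinom]

lemma aperyTerm_nonneg (a : List ℕ) (n : Fin a.length → ℕ) : 0 ≤ aperyTerm a n := by
  rw [aperyTerm_eq]; positivity

lemma tsum_ofReal_aperyTerm (a : List ℕ) :
    ∑' n : decreasingTuples a.length, ENNReal.ofReal (aperyTerm a n) =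
      ∑' m : ℕ, ENNReal.ofReal ((m.centralBinom : ℝ)⁻¹) * ENNReal.ofReal (headWeight a m) := by
  rw [← tsum_decreasingTuples]
  refine tsum_congr fun n => ?_
  rw [aperyTerm_eq, ENNReal.ofReal_mul (by positivity)]

/-- All terms are nonnegative, so a finite value in `ℝ≥0∞` gives summability and the real sum at
once. -/
lemma aperySum_of_tsum_ofReal {a : List ℕ} {x : ℝ} (hx : 0 ≤ x)
    (h : ∑' m : ℕ, ENNReal.ofReal ((m.centralBinom : ℝ)⁻¹) * ENNReal.ofReal (headWeight a m) =
      ENNReal.ofReal x) : AperySummable a ∧ aperySum a = x := by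
  rw [← tsum_ofReal_aperyTerm] at h
  have hs : AperySummable a := by
    have := ENNReal.summable_toReal (h.trans_ne ENNReal.ofReal_ne_top)
    refine this.congr fun n => ?_
    rw [ENNReal.toReal_ofReal (aperyTerm_nonneg a n)]
  refine ⟨hs, ?_⟩
  rw [← ENNReal.ofReal_tsum_of_nonneg (fun n : decreasingTuples a.length =>
    aperyTerm_nonneg a n) hs] at h
  exact (ENNReal.ofReal_eq_ofReal_iff (tsum_nonneg fun n : decreasingTuples a.length =>
    aperyTerm_nonneg a n) hx).1 h

/-! ### Sine powers over central binomials: derivatives and telescoping -/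

/-- The function `(2 sin (t/2))^(2m) / binom(2m, m)`. -/
noncomputable def sinPow (m : ℕ) (t : ℝ) : ℝ :=
  (2 * Real.sin (t / 2)) ^ (2 * m) / (m.centralBinom : ℝ)

/-- The function `cot (t/2) (2 sin (t/2))^(2m) / binom(2m, m)` for `m ≥ 1`. -/
noncomputable def cotSinPow (m : ℕ) (t : ℝ) : ℝ :=
  2 * Real.cos (t / 2) * (2 * Real.sin (t / 2)) ^ (2 * m - 1) / (m.centralBinom : ℝ)

lemma continuous_sinPow (m : ℕ) : Continuous (sinPow m) := by
  unfold sinPow; fun_prop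

lemma continuous_cotSinPow (m : ℕ) : Continuous (cotSinPow m) := by
  unfold cotSinPow; fun_prop

lemma centralBinom_cast_pos (m : ℕ) : (0 : ℝ) < m.centralBinom :=
  Nat.cast_pos.2 m.centralBinom_pos

lemma hasDerivAt_two_mul_sin_half (t : ℝ) :
    HasDerivAt (fun t => 2 * Real.sin (t / 2)) (Real.cos (t / 2)) t := by
  have := (((hasDerivAt_id t).div_const 2).sin).const_mul 2
  exact this.congr_deriv (by simp only [id]; ring)

lemma hasDerivAt_sinPow (m : ℕ) (t : ℝ) :
    HasDerivAt (sinPow (m + 1)) ((m + 1) * cotSinPow (m + 1) t) t := by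
  have := ((hasDerivAt_two_mul_sin_half t).pow (2 * (m + 1))).div_const
    ((m + 1).centralBinom : ℝ)
  refine this.congr_deriv ?_
  unfold cotSinPow
  push_cast
  ring

/-- The recursion `(m+1) binom(2m+2, m+1) = 2(2m+1) binom(2m, m)` together with `cos² = 1 - sin²`
turns the derivative into a difference of consecutive `sinPow`. This is where the central binomial
coefficient matters: it makes the series telescope. -/
lemma hasDerivAt_cotSinPow (m : ℕ) (t : ℝ) :
    HasDerivAt (cotSinPow (m + 1)) ((m + 1) * (sinPow m t - sinPow (m + 1) t)) t := by
  have h1 : HasDerivAt (fun t => 2 * Real.cos (t / 2)) (-Real.sin (t / 2)) t := by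
    have := (((hasDerivAt_id t).div_const 2).cos).const_mul 2
    exact this.congr_deriv (by simp only [id]; ring)
  have := (h1.mul ((hasDerivAt_two_mul_sin_half t).pow (2 * (m + 1) - 1))).div_const
    ((m + 1).centralBinom : ℝ)
  refine this.congr_deriv ?_
  have hC : ((m : ℝ) + 1) * (m + 1).centralBinom = 2 * (2 * m + 1) * m.centralBinom := by
    exact_mod_cast Nat.succ_mul_centralBinom_succ m
  have e1 : 2 * (m + 1) - 1 = 2 * m + 1 := by omega
  have e2 : 2 * (m + 1) = 2 * m + 1 + 1 := by omega
  unfold sinPow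
  rw [e1, Nat.add_sub_cancel, e2]
  have p1 := (centralBinom_cast_pos (m + 1)).ne'
  have p2 := (centralBinom_cast_pos m).ne'
  have hcos := Real.cos_sq' (t / 2)
  simp only [Pi.pow_apply]
  generalize Real.sin (t / 2) = s at *
  generalize Real.cos (t / 2) = c at *
  have hx : (2 * s) ^ (2 * m) / (m.centralBinom : ℝ) * (m + 1) =
      2 * (2 * m + 1) * (2 * s) ^ (2 * m) / ((m + 1).centralBinom : ℝ) := by
    rw [div_mul_eq_mul_div, div_eq_div_iff p2 p1]
    linear_combination (2 * s) ^ (2 * m) * hC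
  rw [mul_sub, mul_comm ((m : ℝ) + 1), hx]
  push_cast
  rw [mul_div_assoc', ← sub_div]
  congr 1
  rw [pow_succ, pow_succ]
  linear_combination 2 * (2 * m + 1) * (2 * s) ^ (2 * m) * hcos

lemma sinPow_succ_zero (m : ℕ) : sinPow (m + 1) 0 = 0 := by simp [sinPow]

lemma cotSinPow_succ_zero (m : ℕ) : cotSinPow (m + 1) 0 = 0 := by
  have e1 : 2 * (m + 1) - 1 = 2 * m + 1 := by omega
  simp [cotSinPow, e1]

lemma integral_cotSinPow (m : ℕ) (t : ℝ) :
    ∫ s in (0 : ℝ)..t, cotSinPow (m + 1) s = sinPow (m + 1) t / (m + 1) := by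
  have h := intervalIntegral.integral_eq_sub_of_hasDerivAt (a := 0) (b := t)
    (fun s _ => hasDerivAt_sinPow m s)
    (((continuous_cotSinPow (m + 1)).const_mul _).intervalIntegrable _ _)
  rw [sinPow_succ_zero, sub_zero, intervalIntegral.integral_const_mul] at h
  rw [← h]
  field_simp

lemma integral_sinPow_sub (m : ℕ) (t : ℝ) :
    (∫ s in (0 : ℝ)..t, sinPow m s) - ∫ s in (0 : ℝ)..t, sinPow (m + 1) s =
      cotSinPow (m + 1) t / (m + 1) := by
  have h := intervalIntegral.integral_eq_sub_of_hasDerivAt (a := 0) (b := t)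
    (fun s _ => hasDerivAt_cotSinPow m s)
    ((((continuous_sinPow m).sub (continuous_sinPow (m + 1))).const_mul _).intervalIntegrable _ _)
  rw [cotSinPow_succ_zero, sub_zero, intervalIntegral.integral_const_mul,
    intervalIntegral.integral_sub ((continuous_sinPow m).intervalIntegrable _ _)
      ((continuous_sinPow (m + 1)).intervalIntegrable _ _)] at h
  rw [← h]
  field_simp


lemma cos_half_pos {t : ℝ} (ht : t ∈ Icc 0 (Real.pi / 3)) :
    0 < Real.cos (t / 2) :=
  Real.cos_pos_of_mem_Ioo ⟨by linarith [ht.1, Real.pi_pos], by linarith [ht.2, Real.pi_pos]⟩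

lemma sin_half_nonneg {t : ℝ} (ht : t ∈ Icc 0 (Real.pi / 3)) :
    0 ≤ Real.sin (t / 2) :=
  Real.sin_nonneg_of_nonneg_of_le_pi (by linarith [ht.1]) (by linarith [ht.2, Real.pi_pos])

lemma two_mul_sin_half_le_one {t : ℝ} (ht : t ∈ Icc 0 (Real.pi / 3)) :
    2 * Real.sin (t / 2) ≤ 1 := by
  have h : Real.sin (t / 2) ≤ Real.sin (Real.pi / 6) :=
    Real.sin_le_sin_of_le_of_le_pi_div_two (by linarith [ht.1, Real.pi_pos])
      (by linarith [Real.pi_pos]) (by linarith [ht.2])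
  rw [Real.sin_pi_div_six] at h
  linarith

lemma sinPow_nonneg {t : ℝ} (ht : t ∈ Icc 0 (Real.pi / 3)) (m : ℕ) : 0 ≤ sinPow m t :=
  div_nonneg (pow_nonneg (by linarith [sin_half_nonneg ht]) _) (Nat.cast_nonneg _)

lemma cotSinPow_nonneg {t : ℝ} (ht : t ∈ Icc 0 (Real.pi / 3)) (m : ℕ) : 0 ≤ cotSinPow m t :=
  div_nonneg (mul_nonneg (by linarith [cos_half_pos ht])
    (pow_nonneg (by linarith [sin_half_nonneg ht]) _)) (Nat.cast_nonneg _)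

lemma sinPow_le {t : ℝ} (ht : t ∈ Icc 0 (Real.pi / 3)) (m : ℕ) : sinPow m t ≤ (m.centralBinom : ℝ)⁻¹ := by
  rw [sinPow, div_eq_mul_inv]
  exact mul_le_of_le_one_left (by positivity)
    (pow_le_one₀ (by linarith [sin_half_nonneg ht]) (two_mul_sin_half_le_one ht))

lemma Icc_pi_div_three_mono {s t : ℝ} (ht : t ∈ Icc 0 (Real.pi / 3)) (hs : s ∈ Ioc 0 t) :
    s ∈ Icc 0 (Real.pi / 3) := ⟨hs.1.le, hs.2.trans ht.2⟩

lemma tendsto_inv_centralBinom :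
    Tendsto (fun m : ℕ => ((m.centralBinom : ℝ))⁻¹) atTop (𝓝 0) := by
  refine squeeze_zero (fun m => by positivity) (fun m => ?_)
    tendsto_one_div_add_atTop_nhds_zero_nat
  rw [one_div]
  refine inv_anti₀ (by positivity) ?_
  have : m + 1 ≤ m.centralBinom := by
    induction m with
    | zero => simp
    | succ m ih =>
      have h := Nat.succ_mul_centralBinom_succ m
      have : (m + 1) * (m + 2) ≤ (m + 1) * (m + 1).centralBinom := by
        rw [h]; nlinarith
      exact Nat.le_of_mul_le_mul_left this (Nat.succ_pos m)
  exact_mod_cast this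

lemma integral_sinPow_nonneg {t : ℝ} (ht : t ∈ Icc 0 (Real.pi / 3)) (m : ℕ) :
    0 ≤ ∫ s in (0 : ℝ)..t, sinPow m s :=
  intervalIntegral.integral_nonneg ht.1 fun _ hs => sinPow_nonneg ⟨hs.1, hs.2.trans ht.2⟩ m

lemma tendsto_integral_sinPow {t : ℝ} (ht : t ∈ Icc 0 (Real.pi / 3)) :
    Tendsto (fun m => ∫ s in (0 : ℝ)..t, sinPow m s) atTop (𝓝 0) := by
  refine squeeze_zero (fun m => integral_sinPow_nonneg ht m) (fun m => ?_)
    (by simpa using tendsto_inv_centralBinom.mul_const t)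
  have := intervalIntegral.integral_mono_on ht.1 ((continuous_sinPow m).intervalIntegrable 0 t)
    (intervalIntegrable_const (μ := volume) (c := ((m.centralBinom : ℝ))⁻¹))
    fun s hs => sinPow_le ⟨hs.1, hs.2.trans ht.2⟩ m
  simpa [mul_comm] using this

/-- By `integral_sinPow_sub` the partial sums telescope, and the remaining integral vanishes in the
limit because `sinPow m` is at most `1 / binom(2m, m)` on `[0, π/3]`. -/
lemma hasSum_cotSinPow {t : ℝ} (ht : t ∈ Icc 0 (Real.pi / 3)) (m : ℕ) :
    HasSum (fun k : ℕ => cotSinPow (m + k + 1) t / ((m + k : ℕ) + 1))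
      (∫ s in (0 : ℝ)..t, sinPow m s) := by
  rw [hasSum_iff_tendsto_nat_of_nonneg fun k => div_nonneg (cotSinPow_nonneg ht _) (by positivity)]
  have h : ∀ n, ∑ k ∈ Finset.range n, cotSinPow (m + k + 1) t / ((m + k : ℕ) + 1) =
      (∫ s in (0 : ℝ)..t, sinPow m s) - ∫ s in (0 : ℝ)..t, sinPow (m + n) s := by
    intro n
    have := Finset.sum_range_sub' (fun k => ∫ s in (0 : ℝ)..t, sinPow (m + k) s) n
    rw [add_zero] at this
    rw [← this]
    exact Finset.sum_congr rfl fun k _ => (integral_sinPow_sub (m + k) t).symm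
  simp_rw [h]
  have := (tendsto_integral_sinPow ht).comp (tendsto_add_atTop_nat m)
  simpa [Function.comp_def, add_comm] using this.const_sub (∫ s in (0 : ℝ)..t, sinPow m s)

lemma tsum_ite_lt_cotSinPow {t : ℝ} (ht : t ∈ Icc 0 (Real.pi / 3)) (j : ℕ) :
    ∑' m : ℕ, (if j < m then ENNReal.ofReal (cotSinPow m t / m) else 0) =
      ENNReal.ofReal (∫ s in (0 : ℝ)..t, sinPow j s) := by
  have h := hasSum_cotSinPow ht j
  rw [← h.tsum_eq, ENNReal.ofReal_tsum_of_nonneg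
    (fun k => div_nonneg (cotSinPow_nonneg ht _) (by positivity)) h.summable]
  rw [← ENNReal.summable.sum_add_tsum_nat_add' (k := j + 1), Finset.sum_eq_zero, zero_add]
  · refine tsum_congr fun k => ?_
    rw [if_pos (by omega)]
    have e : k + (j + 1) = j + k + 1 := by omega
    rw [e]
    push_cast
    rfl
  · intro m hm
    rw [if_neg (by have := Finset.mem_range.1 hm; omega)]

lemma ofReal_integral_of_continuous {f : ℝ → ℝ} (hf : Continuous f) {t : ℝ} (ht : 0 ≤ t)
    (h0 : ∀ s ∈ Ioc 0 t, 0 ≤ f s) :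
    ENNReal.ofReal (∫ s in (0 : ℝ)..t, f s) = ∫⁻ s in Ioc 0 t, ENNReal.ofReal (f s) := by
  rw [intervalIntegral.integral_of_le ht, ofReal_integral_eq_lintegral_ofReal]
  · exact (hf.integrableOn_Icc).mono_set Ioc_subset_Icc_self
  · exact (ae_restrict_iff' measurableSet_Ioc).2 (ae_of_all _ h0)

/-! ### Generating series and their integral recursions -/

/-- The generating series `∑ (2 sin (t/2))^(2n₁) / binom(2n₁, n₁) n₁^(-a₁) ⋯ n_r^(-a_r)`. -/
noncomputable def aperySeries (a : List ℕ) (t : ℝ) : ℝ≥0∞ :=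
  ∑' m : ℕ, ENNReal.ofReal (sinPow m t) * ENNReal.ofReal (headWeight a m)

lemma aperySeries_nil (t : ℝ) : aperySeries [] t = 1 := by
  rw [aperySeries, tsum_eq_single 0 (by intro m hm; simp [headWeight, hm])]
  simp [headWeight, sinPow]

lemma lintegral_aperySeries {t : ℝ} (ht : t ∈ Icc 0 (Real.pi / 3)) (a : List ℕ) :
    ∫⁻ s in Ioc 0 t, aperySeries a s =
      ∑' j : ℕ, ENNReal.ofReal (∫ s in (0 : ℝ)..t, sinPow j s) *
        ENNReal.ofReal (headWeight a j) := by
  unfold aperySeries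
  have hm : ∀ j, Measurable fun s => ENNReal.ofReal (sinPow j s) := fun j =>
    (continuous_sinPow j).measurable.ennreal_ofReal
  rw [lintegral_tsum fun j => ((hm j).mul_const _).aemeasurable]
  refine tsum_congr fun j => ?_
  rw [lintegral_mul_const _ (hm j), ofReal_integral_of_continuous (continuous_sinPow j) ht.1
    fun s hs => sinPow_nonneg (Icc_pi_div_three_mono ht hs) j]

/-- Write `sinPow m = tan (t/2) * cotSinPow m` for `m ≥ 1` and exchange the sums over `m` and over
the second entry `j`; the sum over `m > j` telescopes to the integral of `sinPow j`. -/
lemma aperySeries_one_cons {t : ℝ} (ht : t ∈ Icc 0 (Real.pi / 3)) (a : List ℕ) :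
    aperySeries (1 :: a) t =
      ENNReal.ofReal (Real.sin (t / 2) / Real.cos (t / 2)) * ∫⁻ s in Ioc 0 t, aperySeries a s := by
  have hc := cos_half_pos ht
  have hs := sin_half_nonneg ht
  have h0 : 0 ≤ Real.sin (t / 2) / Real.cos (t / 2) := div_nonneg hs hc.le
  have hterm : ∀ m : ℕ, ENNReal.ofReal (sinPow m t) * ENNReal.ofReal (headWeight (1 :: a) m) =
      ENNReal.ofReal (Real.sin (t / 2) / Real.cos (t / 2)) *
        ∑' j : ℕ, (if j < m then ENNReal.ofReal (cotSinPow m t / m) else 0) *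
          ENNReal.ofReal (headWeight a j) := by
    intro m
    rw [tsum_eq_sum (s := Finset.range m) (fun j hj => by
      rw [if_neg (by simpa using hj), zero_mul])]
    have : ∑ j ∈ Finset.range m, (if j < m then ENNReal.ofReal (cotSinPow m t / m) else 0) *
        ENNReal.ofReal (headWeight a j) = ENNReal.ofReal (cotSinPow m t / m) *
          ENNReal.ofReal (∑ j ∈ Finset.range m, headWeight a j) := by
      rw [ENNReal.ofReal_sum_of_nonneg fun j _ => headWeight_nonneg a j, Finset.mul_sum]
      refine Finset.sum_congr rfl fun j hj => ?_
      rw [if_pos (Finset.mem_range.1 hj)]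
    rw [this]
    rcases m with _ | m
    · simp [headWeight]
    · rw [← mul_assoc, ← ENNReal.ofReal_mul h0, ← ENNReal.ofReal_mul (sinPow_nonneg ht _),
        ← ENNReal.ofReal_mul (mul_nonneg h0 (div_nonneg (cotSinPow_nonneg ht _) (by positivity)))]
      congr 1
      simp only [headWeight, Nat.succ_ne_zero, if_false, pow_one]
      have e1 : 2 * (m + 1) - 1 = 2 * m + 1 := by omega
      have e2 : 2 * (m + 1) = 2 * m + 1 + 1 := by omega
      unfold sinPow cotSinPow
      rw [e1, e2, pow_succ _ (2 * m + 1)]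
      have := (centralBinom_cast_pos (m + 1)).ne'
      field_simp
  unfold aperySeries
  simp_rw [hterm]
  rw [ENNReal.tsum_mul_left, ENNReal.tsum_comm]
  congr 1
  have := lintegral_aperySeries ht a
  unfold aperySeries at this
  rw [this]
  refine tsum_congr fun j => ?_
  rw [ENNReal.tsum_mul_right, tsum_ite_lt_cotSinPow ht]

/-- Multiplying `sinPow m` by `cot (s/2)` gives `cotSinPow m`, whose integral is `sinPow m / m`: one
more factor `1 / n₁`. -/
lemma aperySeries_succ_cons {t : ℝ} (ht : t ∈ Icc 0 (Real.pi / 3)) (c : ℕ) (a : List ℕ) :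
    aperySeries ((c + 1) :: a) t =
      ∫⁻ s in Ioc 0 t, ENNReal.ofReal (Real.cos (s / 2) / Real.sin (s / 2)) *
        aperySeries (c :: a) s := by
  have hterm : ∀ s ∈ Ioc 0 t, ENNReal.ofReal (Real.cos (s / 2) / Real.sin (s / 2)) *
      aperySeries (c :: a) s = ∑' m : ℕ, ENNReal.ofReal (cotSinPow m s) *
        ENNReal.ofReal (headWeight (c :: a) m) := by
    intro s hs
    have hs' := Icc_pi_div_three_mono ht hs
    have hsin : 0 < Real.sin (s / 2) :=
      Real.sin_pos_of_pos_of_lt_pi (by linarith [hs.1]) (by linarith [hs'.2, Real.pi_pos])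
    unfold aperySeries
    rw [← ENNReal.tsum_mul_left]
    refine tsum_congr fun m => ?_
    rcases m with _ | m
    · simp [headWeight]
    · rw [← mul_assoc, ← ENNReal.ofReal_mul (div_nonneg (cos_half_pos hs').le hsin.le)]
      congr 2
      have e1 : 2 * (m + 1) - 1 = 2 * m + 1 := by omega
      have e2 : 2 * (m + 1) = 2 * m + 1 + 1 := by omega
      unfold sinPow cotSinPow
      rw [e1, e2, pow_succ _ (2 * m + 1)]
      have := (centralBinom_cast_pos (m + 1)).ne'
      field_simp
  rw [setLIntegral_congr_fun measurableSet_Ioc hterm]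
  have hm : ∀ j, Measurable fun s => ENNReal.ofReal (cotSinPow j s) := fun j =>
    (continuous_cotSinPow j).measurable.ennreal_ofReal
  rw [lintegral_tsum fun j => ((hm j).mul_const _).aemeasurable]
  refine tsum_congr fun m => ?_
  rw [lintegral_mul_const _ (hm m), ← ofReal_integral_of_continuous (continuous_cotSinPow m) ht.1
    fun s hs => cotSinPow_nonneg (Icc_pi_div_three_mono ht hs) m]
  rcases m with _ | m
  · simp [headWeight]
  · rw [integral_cotSinPow, ← ENNReal.ofReal_mul (sinPow_nonneg ht _),
      ← ENNReal.ofReal_mul (div_nonneg (sinPow_nonneg ht _) (by positivity))]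
    congr 1
    simp only [headWeight, Nat.succ_ne_zero, if_false]
    push_cast
    rw [pow_succ]
    field_simp

lemma aperySeries_two_cons {t : ℝ} (ht : t ∈ Icc 0 (Real.pi / 3)) (a : List ℕ) :
    aperySeries (2 :: a) t = ∫⁻ s in Ioc 0 t, ∫⁻ x in Ioc 0 s, aperySeries a x := by
  rw [aperySeries_succ_cons ht]
  refine setLIntegral_congr_fun measurableSet_Ioc fun s hs => ?_
  have hs' := Icc_pi_div_three_mono ht hs
  have hsin : 0 < Real.sin (s / 2) :=
    Real.sin_pos_of_pos_of_lt_pi (by linarith [hs.1]) (by linarith [hs'.2, Real.pi_pos])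
  have hc := cos_half_pos hs'
  rw [aperySeries_one_cons hs', ← mul_assoc, ← ENNReal.ofReal_mul (by positivity)]
  have : Real.cos (s / 2) / Real.sin (s / 2) * (Real.sin (s / 2) / Real.cos (s / 2)) = 1 := by
    field_simp
  rw [this, ENNReal.ofReal_one, one_mul]

/-! ### Repeated integration and the blocks of twos -/

/-- The `(p+1)`-fold iterated integral of `f` from `0` to `t`, as a single integral. -/
noncomputable def iteratedLIntegral (p : ℕ) (f : ℝ → ℝ≥0∞) (t : ℝ) : ℝ≥0∞ :=
  ∫⁻ s in Ioc 0 t, ENNReal.ofReal ((t - s) ^ p / p.factorial) * f s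

lemma iteratedLIntegral_zero (f : ℝ → ℝ≥0∞) (t : ℝ) :
    iteratedLIntegral 0 f t = ∫⁻ s in Ioc 0 t, f s := by
  simp [iteratedLIntegral]

lemma integral_sub_pow_div_factorial (p : ℕ) (s t : ℝ) :
    ∫ x in s..t, (x - s) ^ p / (p.factorial : ℝ) = (t - s) ^ (p + 1) / (p + 1).factorial := by
  rw [intervalIntegral.integral_div, intervalIntegral.integral_comp_sub_right (fun x => x ^ p) s,
    integral_pow, Nat.factorial_succ]
  push_cast
  rw [sub_self, zero_pow (by omega), sub_zero, div_div]

lemma lintegral_pow_div_factorial (q : ℕ) {t : ℝ} (ht : 0 ≤ t) :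
    ∫⁻ s in Ioc 0 t, ENNReal.ofReal (s ^ q / q.factorial) =
      ENNReal.ofReal (t ^ (q + 1) / (q + 1).factorial) := by
  have h := integral_sub_pow_div_factorial q 0 t
  simp only [sub_zero] at h
  rw [← h, ofReal_integral_of_continuous (by fun_prop) ht]
  intro s hs
  have := hs.1.le
  positivity

/-- Cauchy's formula for repeated integration: Tonelli on the triangle `0 < s < x ≤ t`, then the
inner integral of `(x - s)^p / p!` over `x`. -/
lemma lintegral_iteratedLIntegral (p : ℕ) {f : ℝ → ℝ≥0∞} (hf : Measurable f) (t : ℝ) :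
    ∫⁻ x in Ioc 0 t, iteratedLIntegral p f x = iteratedLIntegral (p + 1) f t := by
  -- The indicator carries the triangle, so both variables range over the fixed interval `Ioc 0 t`
  -- and the integrals can be swapped.
  set K : ℝ → ℝ → ℝ≥0∞ := fun x s =>
    {z : ℝ × ℝ | z.2 < z.1}.indicator
      (fun z => ENNReal.ofReal ((z.1 - z.2) ^ p / p.factorial) * f z.2) (x, s) with hK
  have hKm : Measurable (Function.uncurry K) := by
    have h1 : Measurable fun z : ℝ × ℝ =>
        ENNReal.ofReal ((z.1 - z.2) ^ p / p.factorial) * f z.2 :=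
      (by fun_prop : Measurable fun z : ℝ × ℝ =>
        ENNReal.ofReal ((z.1 - z.2) ^ p / p.factorial)).mul (hf.comp measurable_snd)
    exact h1.indicator (measurableSet_lt measurable_snd measurable_fst)
  have h1 : ∀ x ∈ Ioc 0 t, iteratedLIntegral p f x = ∫⁻ s in Ioc 0 t, K x s := by
    intro x hx
    have e : ∀ s, K x s = (Iio x).indicator
        (fun s => ENNReal.ofReal ((x - s) ^ p / p.factorial) * f s) s := fun s => rfl
    simp_rw [e]
    rw [setLIntegral_indicator measurableSet_Iio]
    have : Iio x ∩ Ioc 0 t = Ioo 0 x := by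
      ext s
      simp only [mem_inter_iff, mem_Iio, mem_Ioc, mem_Ioo]
      exact ⟨fun h => ⟨h.2.1, h.1⟩, fun h => ⟨h.2, h.1, h.2.le.trans hx.2⟩⟩
    rw [this, iteratedLIntegral, setLIntegral_congr Ioo_ae_eq_Ioc]
  rw [setLIntegral_congr_fun measurableSet_Ioc h1, lintegral_lintegral_swap hKm.aemeasurable,
    iteratedLIntegral]
  refine setLIntegral_congr_fun measurableSet_Ioc fun s hs => ?_
  have e : ∀ x, K x s = (Ioi s).indicator
      (fun x => ENNReal.ofReal ((x - s) ^ p / p.factorial) * f s) x := fun x => rfl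
  simp_rw [e]
  rw [setLIntegral_indicator measurableSet_Ioi]
  have : Ioi s ∩ Ioc 0 t = Ioc s t := by
    ext x
    simp only [mem_inter_iff, mem_Ioi, mem_Ioc]
    exact ⟨fun h => ⟨h.1, h.2.2⟩, fun h => ⟨h.1, hs.1.trans h.1, h.2⟩⟩
  rw [this, lintegral_mul_const _ (by fun_prop), ← integral_sub_pow_div_factorial,
    intervalIntegral.integral_of_le hs.2, ofReal_integral_eq_lintegral_ofReal]
  · exact (by fun_prop : Continuous fun x : ℝ => (x - s) ^ p / (p.factorial : ℝ)).integrableOn_Icc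
      |>.mono_set Ioc_subset_Icc_self
  · refine (ae_restrict_iff' measurableSet_Ioc).2 (ae_of_all _ fun x hx => ?_)
    have := sub_nonneg.2 hx.1.le
    simp only [Pi.zero_apply]
    positivity

lemma aperySeries_replicate_two (b : ℕ) {t : ℝ} (ht : t ∈ Icc 0 (Real.pi / 3)) :
    aperySeries (List.replicate b 2) t = ENNReal.ofReal (t ^ (2 * b) / (2 * b).factorial) := by
  induction b generalizing t with
  | zero => simp [aperySeries_nil]
  | succ b ih =>
    rw [List.replicate_succ, aperySeries_two_cons ht]
    have h : ∀ s ∈ Ioc 0 t, ∫⁻ x in Ioc 0 s, aperySeries (List.replicate b 2) x =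
        ENNReal.ofReal (s ^ (2 * b + 1) / (2 * b + 1).factorial) := by
      intro s hs
      have hs' := Icc_pi_div_three_mono ht hs
      rw [setLIntegral_congr_fun measurableSet_Ioc fun x hx => ih (Icc_pi_div_three_mono hs' hx),
        lintegral_pow_div_factorial _ hs'.1]
    rw [setLIntegral_congr_fun measurableSet_Ioc h, lintegral_pow_div_factorial _ ht.1]
    rfl

lemma aperySeries_one_cons_replicate_two (b : ℕ) {t : ℝ} (ht : t ∈ Icc 0 (Real.pi / 3)) :
    aperySeries (1 :: List.replicate b 2) t =
      ENNReal.ofReal (t ^ (2 * b + 1) / (2 * b + 1).factorial *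
        (Real.sin (t / 2) / Real.cos (t / 2))) := by
  rw [aperySeries_one_cons ht, setLIntegral_congr_fun measurableSet_Ioc
    fun x hx => aperySeries_replicate_two b (Icc_pi_div_three_mono ht hx),
    lintegral_pow_div_factorial _ ht.1,
    ← ENNReal.ofReal_mul (div_nonneg (sin_half_nonneg ht) (cos_half_pos ht).le), mul_comm]

lemma aperySeries_three_cons_replicate_two (b : ℕ) {t : ℝ} (ht : t ∈ Icc 0 (Real.pi / 3)) :
    aperySeries (3 :: List.replicate b 2) t =
      iteratedLIntegral 0 (fun s => ENNReal.ofReal (s ^ (2 * b + 2) / (2 * b + 2).factorial *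
        (Real.cos (s / 2) / Real.sin (s / 2)))) t := by
  rw [aperySeries_succ_cons ht, iteratedLIntegral_zero]
  refine setLIntegral_congr_fun measurableSet_Ioc fun x hx => ?_
  have hx' := Icc_pi_div_three_mono ht hx
  rw [← List.replicate_succ, aperySeries_replicate_two _ hx',
    ← ENNReal.ofReal_mul (div_nonneg (cos_half_pos hx').le (sin_half_nonneg hx')), mul_comm]
  rfl

lemma aperySeries_two_cons_of_eq {l : List ℕ} {p : ℕ} {f : ℝ → ℝ≥0∞} (hf : Measurable f)
    (h : ∀ t ∈ Icc 0 (Real.pi / 3), aperySeries l t = iteratedLIntegral p f t)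
    {t : ℝ} (ht : t ∈ Icc 0 (Real.pi / 3)) :
    aperySeries (2 :: l) t = iteratedLIntegral (p + 2) f t := by
  rw [aperySeries_two_cons ht, ← lintegral_iteratedLIntegral (p + 1) hf]
  refine setLIntegral_congr_fun measurableSet_Ioc fun x hx => ?_
  have hx' := Icc_pi_div_three_mono ht hx
  rw [← lintegral_iteratedLIntegral p hf]
  exact setLIntegral_congr_fun measurableSet_Ioc fun y hy => h y (Icc_pi_div_three_mono hx' hy)

lemma aperySeries_replicate_two_append {l : List ℕ} {p : ℕ} {f : ℝ → ℝ≥0∞} (hf : Measurable f)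
    (h : ∀ t ∈ Icc 0 (Real.pi / 3), aperySeries l t = iteratedLIntegral p f t) (a : ℕ) :
    ∀ t ∈ Icc 0 (Real.pi / 3),
      aperySeries (List.replicate a 2 ++ l) t = iteratedLIntegral (p + 2 * a) f t := by
  induction a with
  | zero => simpa using h
  | succ a ih =>
    intro t ht
    rw [List.replicate_succ, List.cons_append, aperySeries_two_cons_of_eq hf ih ht]
    rfl

lemma pi_div_three_mem : Real.pi / 3 ∈ Icc 0 (Real.pi / 3) :=
  ⟨by positivity, le_rfl⟩

lemma aperySeries_pi_div_three (a : List ℕ) :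
    aperySeries a (Real.pi / 3) =
      ∑' m : ℕ, ENNReal.ofReal ((m.centralBinom : ℝ)⁻¹) * ENNReal.ofReal (headWeight a m) := by
  refine tsum_congr fun m => ?_
  have : Real.pi / 3 / 2 = Real.pi / 6 := by ring
  simp [sinPow, this]

/-! ### The Apéry-like sums as single integrals over `[0, π/3]` -/

/-- The beta kernel `(T - s)^p / p! * s^q / q!`. -/
noncomputable def betaKernel (p q : ℕ) (T s : ℝ) : ℝ :=
  (T - s) ^ p / p.factorial * (s ^ q / q.factorial)

lemma continuous_betaKernel (p q : ℕ) (T : ℝ) : Continuous (betaKernel p q T) := by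
  unfold betaKernel; fun_prop

lemma betaKernel_nonneg {p q : ℕ} {T s : ℝ} (h0 : 0 ≤ s) (h1 : s ≤ T) :
    0 ≤ betaKernel p q T s := by
  have := sub_nonneg.2 h1
  unfold betaKernel; positivity

lemma intervalIntegrable_betaKernel_mul_tan (p q : ℕ) :
    IntervalIntegrable (fun s => betaKernel p q (Real.pi / 3) s *
      (Real.sin (s / 2) / Real.cos (s / 2))) volume 0 (Real.pi / 3) := by
  refine ContinuousOn.intervalIntegrable ?_
  rw [uIcc_of_le (by positivity)]
  refine (continuous_betaKernel p q _).continuousOn.mul (ContinuousOn.div (by fun_prop)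
    (by fun_prop) fun s hs => (cos_half_pos hs).ne')

/-- One factor `s` taken from `s^q` absorbs the pole of the cotangent: Jordan's inequality `sin x ≥
2x/π` bounds `s cot (s/2)` by `π`. -/
lemma intervalIntegrable_betaKernel_mul_cot (p : ℕ) {q : ℕ} (hq : 1 ≤ q) :
    IntervalIntegrable (fun s => betaKernel p q (Real.pi / 3) s *
      (Real.cos (s / 2) / Real.sin (s / 2))) volume 0 (Real.pi / 3) := by
  obtain ⟨q, rfl⟩ := Nat.exists_eq_add_of_le' hq
  have h1 : IntervalIntegrable (fun s => s * (Real.cos (s / 2) / Real.sin (s / 2)))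
      volume 0 (Real.pi / 3) := by
    rw [intervalIntegrable_iff_integrableOn_Ioc_of_le (by positivity)]
    refine Measure.integrableOn_of_bounded (M := Real.pi) (by simp) ?_ ?_
    · exact (measurable_id.mul ((Real.measurable_cos.comp (measurable_id.div_const 2)).div
        (Real.measurable_sin.comp (measurable_id.div_const 2)))).aestronglyMeasurable
    · refine (ae_restrict_iff' measurableSet_Ioc).2 (ae_of_all _ fun s hs => ?_)
      have hs' := Icc_pi_div_three_mono pi_div_three_mem hs
      have h2 := Real.mul_le_sin (x := s / 2) (by linarith [hs.1]) (by linarith [hs.2, Real.pi_pos])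
      have h3 : 0 < Real.sin (s / 2) :=
        lt_of_lt_of_le (mul_pos (by positivity) (by linarith [hs.1])) h2
      rw [Real.norm_eq_abs, abs_of_nonneg (mul_nonneg hs.1.le
        (div_nonneg (cos_half_pos hs').le h3.le)), mul_div_assoc', div_le_iff₀ h3]
      have h4 : s = Real.pi * (2 / Real.pi * (s / 2)) := by field_simp
      calc s * Real.cos (s / 2) ≤ s * 1 :=
            mul_le_mul_of_nonneg_left (Real.cos_le_one _) hs.1.le
        _ = Real.pi * (2 / Real.pi * (s / 2)) := by rw [mul_one]; exact h4
        _ ≤ Real.pi * Real.sin (s / 2) := mul_le_mul_of_nonneg_left h2 Real.pi_pos.le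
  have h2 : ContinuousOn (fun s : ℝ => (Real.pi / 3 - s) ^ p / (p.factorial : ℝ) *
      (s ^ q / (q + 1).factorial)) (uIcc 0 (Real.pi / 3)) := by fun_prop
  refine (h1.mul_continuousOn h2).congr fun s _ => ?_
  unfold betaKernel
  ring

lemma aperySum_of_iteratedLIntegral {l : List ℕ} {p q : ℕ} {g : ℝ → ℝ}
    (hg : ∀ s ∈ Ioc 0 (Real.pi / 3), 0 ≤ g s)
    (hi : IntervalIntegrable (fun s => betaKernel p q (Real.pi / 3) s * g s) volume 0
      (Real.pi / 3))
    (h : aperySeries l (Real.pi / 3) =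
      iteratedLIntegral p (fun s => ENNReal.ofReal (s ^ q / q.factorial * g s)) (Real.pi / 3)) :
    AperySummable l ∧
      aperySum l = ∫ s in (0 : ℝ)..(Real.pi / 3), betaKernel p q (Real.pi / 3) s * g s := by
  have hT : 0 ≤ Real.pi / 3 := by positivity
  have h0 : ∀ s ∈ Ioc 0 (Real.pi / 3), 0 ≤ betaKernel p q (Real.pi / 3) s * g s := fun s hs =>
    mul_nonneg (betaKernel_nonneg hs.1.le hs.2) (hg s hs)
  rw [intervalIntegral.integral_of_le hT]
  refine aperySum_of_tsum_ofReal (setIntegral_nonneg measurableSet_Ioc h0) ?_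
  rw [← aperySeries_pi_div_three, h, ofReal_integral_eq_lintegral_ofReal
    ((intervalIntegrable_iff_integrableOn_Ioc_of_le hT).1 hi)
    ((ae_restrict_iff' measurableSet_Ioc).2 (ae_of_all _ h0))]
  refine setLIntegral_congr_fun measurableSet_Ioc fun s hs => ?_
  simp only
  have := sub_nonneg.2 hs.2
  rw [← ENNReal.ofReal_mul (by positivity), betaKernel, mul_assoc]

/-- The series of `1, 2, …, 2` has its tangent outside any integral, so the induction on twos starts
from `2, 1, 2, …, 2`, a double integral. This is why at least one 2 must precede the 1. -/
theorem aperySum_twosAround_one (a b : ℕ) :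
    AperySummable (twosAround (a + 1) 1 b) ∧ aperySum (twosAround (a + 1) 1 b) =
      ∫ s in (0 : ℝ)..(Real.pi / 3), betaKernel (2 * a + 1) (2 * b + 1) (Real.pi / 3) s *
        (Real.sin (s / 2) / Real.cos (s / 2)) := by
  have hf : Measurable fun s : ℝ => ENNReal.ofReal (s ^ (2 * b + 1) / (2 * b + 1).factorial *
        (Real.sin (s / 2) / Real.cos (s / 2))) := by
    refine Measurable.ennreal_ofReal (((measurable_id.pow_const _).div_const _).mul ?_)
    exact (Real.measurable_sin.comp (measurable_id.div_const 2)).div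
        (Real.measurable_cos.comp (measurable_id.div_const 2))
  refine aperySum_of_iteratedLIntegral (fun s hs => ?_)
    (intervalIntegrable_betaKernel_mul_tan _ _) ?_
  · have hs' := Icc_pi_div_three_mono pi_div_three_mem hs
    exact div_nonneg (sin_half_nonneg hs') (cos_half_pos hs').le
  · have h : ∀ t ∈ Icc 0 (Real.pi / 3), aperySeries (2 :: 1 :: List.replicate b 2) t =
        iteratedLIntegral 1 (fun s => ENNReal.ofReal (s ^ (2 * b + 1) / (2 * b + 1).factorial *
          (Real.sin (s / 2) / Real.cos (s / 2)))) t := by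
      intro t ht
      rw [aperySeries_two_cons ht, ← lintegral_iteratedLIntegral 0 hf]
      refine setLIntegral_congr_fun measurableSet_Ioc fun x hx => ?_
      have hx' := Icc_pi_div_three_mono ht hx
      rw [iteratedLIntegral_zero]
      exact setLIntegral_congr_fun measurableSet_Ioc fun y hy =>
        aperySeries_one_cons_replicate_two b (Icc_pi_div_three_mono hx' hy)
    have e : twosAround (a + 1) 1 b = List.replicate a 2 ++ 2 :: 1 :: List.replicate b 2 := by
      simp [twosAround, List.replicate_succ']
    rw [e, aperySeries_replicate_two_append hf h a _ pi_div_three_mem, add_comm 1]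

theorem aperySum_twosAround_three (a b : ℕ) :
    AperySummable (twosAround a 3 b) ∧ aperySum (twosAround a 3 b) =
      ∫ s in (0 : ℝ)..(Real.pi / 3), betaKernel (2 * a) (2 * b + 2) (Real.pi / 3) s *
        (Real.cos (s / 2) / Real.sin (s / 2)) := by
  have hf : Measurable fun s : ℝ => ENNReal.ofReal (s ^ (2 * b + 2) / (2 * b + 2).factorial *
        (Real.cos (s / 2) / Real.sin (s / 2))) := by
    refine Measurable.ennreal_ofReal (((measurable_id.pow_const _).div_const _).mul ?_)
    exact (Real.measurable_cos.comp (measurable_id.div_const 2)).div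
        (Real.measurable_sin.comp (measurable_id.div_const 2))
  refine aperySum_of_iteratedLIntegral (fun s hs => ?_)
    (intervalIntegrable_betaKernel_mul_cot _ (by omega)) ?_
  · have hs' := Icc_pi_div_three_mono pi_div_three_mem hs
    exact div_nonneg (cos_half_pos hs').le (sin_half_nonneg hs')
  · rw [twosAround, aperySeries_replicate_two_append hf
      (fun t ht => aperySeries_three_cons_replicate_two b ht) a _ pi_div_three_mem, zero_add]

/-! ### Integration by parts against exponentials -/

lemma mul_integral_mul_cexp {P P' : ℝ → ℝ} (hP : ∀ s, HasDerivAt P (P' s) s)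
    (hP' : Continuous P') (z : ℂ) (T : ℝ) :
    z * ∫ s in (0 : ℝ)..T, (P s : ℂ) * Complex.exp (z * s) =
      P T * Complex.exp (z * T) - P 0 - ∫ s in (0 : ℝ)..T, (P' s : ℂ) * Complex.exp (z * s) := by
  have hPc : Continuous P := continuous_iff_continuousAt.2 fun s => (hP s).continuousAt
  have hd : ∀ s : ℝ, HasDerivAt (fun s : ℝ => (P s : ℂ) * Complex.exp (z * s))
      ((P' s : ℂ) * Complex.exp (z * s) + z * ((P s : ℂ) * Complex.exp (z * s))) s := by
    intro s
    have h1 : HasDerivAt (fun s : ℝ => Complex.exp (z * s)) (Complex.exp (z * s) * z) s := by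
      have h2 : HasDerivAt (fun s : ℝ => z * (s : ℂ)) z s := by
        simpa using (Complex.ofRealCLM.hasDerivAt (x := s)).const_mul z
      exact h2.cexp
    exact ((hP s).ofReal_comp.mul h1).congr_deriv (by ring)
  have c1 : Continuous fun s : ℝ => (P' s : ℂ) * Complex.exp (z * s) := by fun_prop
  have c2 : Continuous fun s : ℝ => z * ((P s : ℂ) * Complex.exp (z * s)) := by fun_prop
  have h := intervalIntegral.integral_eq_sub_of_hasDerivAt (a := 0) (b := T) (fun s _ => hd s)
    ((c1.add c2).intervalIntegrable _ _)
  rw [intervalIntegral.integral_add (c1.intervalIntegrable _ _) (c2.intervalIntegrable _ _),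
    intervalIntegral.integral_const_mul] at h
  simp only [Complex.ofReal_zero, mul_zero, Complex.exp_zero, mul_one] at h
  linear_combination h

lemma hasDerivAt_pow_div_factorial (q : ℕ) (s : ℝ) :
    HasDerivAt (fun s : ℝ => s ^ (q + 1) / ((q + 1).factorial : ℝ)) (s ^ q / q.factorial) s := by
  refine ((hasDerivAt_pow (q + 1) s).div_const _).congr_deriv ?_
  rw [Nat.factorial_succ]
  have := Nat.factorial_ne_zero q
  push_cast
  field_simp

lemma hasDerivAt_sub_pow_div_factorial (p : ℕ) (T s : ℝ) :
    HasDerivAt (fun s : ℝ => (T - s) ^ (p + 1) / ((p + 1).factorial : ℝ))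
      (-((T - s) ^ p / p.factorial)) s := by
  have h := (hasDerivAt_pow_div_factorial p (T - s)).comp s ((hasDerivAt_id s).const_sub T)
  exact h.congr_deriv (by simp)

lemma hasDerivAt_betaKernel_succ_succ (p q : ℕ) (T s : ℝ) :
    HasDerivAt (betaKernel (p + 1) (q + 1) T)
      (betaKernel (p + 1) q T s - betaKernel p (q + 1) T s) s :=
  ((hasDerivAt_sub_pow_div_factorial p T s).mul (hasDerivAt_pow_div_factorial q s)).congr_deriv
    (by unfold betaKernel; ring)

lemma hasDerivAt_betaKernel_zero_succ (q : ℕ) (T s : ℝ) :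
    HasDerivAt (betaKernel 0 (q + 1) T) (betaKernel 0 q T s) s := by
  have e : betaKernel 0 (q + 1) T = fun s => s ^ (q + 1) / ((q + 1).factorial : ℝ) := by
    ext s; simp [betaKernel]
  rw [e]
  exact (hasDerivAt_pow_div_factorial q s).congr_deriv (by simp [betaKernel])

lemma hasDerivAt_betaKernel_succ_zero (p : ℕ) (T s : ℝ) :
    HasDerivAt (betaKernel (p + 1) 0 T) (-betaKernel p 0 T s) s := by
  have e : betaKernel (p + 1) 0 T = fun s => (T - s) ^ (p + 1) / ((p + 1).factorial : ℝ) := by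
    ext s; simp [betaKernel]
  rw [e]
  exact (hasDerivAt_sub_pow_div_factorial p T s).congr_deriv (by simp [betaKernel])

lemma hasDerivAt_betaKernel_zero_zero (T s : ℝ) :
    HasDerivAt (betaKernel 0 0 T) 0 s := by
  have e : betaKernel 0 0 T = fun s => 1 := by
    ext s; simp [betaKernel]
  rw [e]
  exact hasDerivAt_const s 1

/-- Closed form of `∫₀ᵀ (T - s)^p / p! * s^q / q! * exp (z s) ds`, with `E = exp (z T)`. -/
noncomputable def betaExp (p q : ℕ) (T : ℝ) (z E : ℂ) : ℂ :=
  ∑ j ∈ Finset.range (p + q + 1), (T : ℂ) ^ (p + q - j) / ((p + q - j).factorial : ℂ) *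
    z⁻¹ ^ (j + 1) * ((-1) ^ (j + p) * (j.choose p : ℂ) * E - (-1) ^ q * (j.choose q : ℂ))

lemma mul_betaExp (p q : ℕ) (T : ℝ) {z : ℂ} (hz : z ≠ 0) (E : ℂ) :
    z * betaExp p q T z E = (∑ j ∈ Finset.range (p + q),
      (T : ℂ) ^ (p + q - (j + 1)) / ((p + q - (j + 1)).factorial : ℂ) * z⁻¹ ^ (j + 1) *
        ((-1) ^ (j + 1 + p) * ((j + 1).choose p : ℂ) * E - (-1) ^ q * ((j + 1).choose q : ℂ))) +
      (T : ℂ) ^ (p + q) / ((p + q).factorial : ℂ) *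
        ((-1) ^ p * ((0 : ℕ).choose p : ℂ) * E - (-1) ^ q * ((0 : ℕ).choose q : ℂ)) := by
  rw [betaExp, Finset.sum_range_succ', mul_add, Finset.mul_sum]
  congr 1
  · refine Finset.sum_congr rfl fun j _ => ?_
    rw [pow_succ _ (j + 1)]
    field_simp
  · simp only [Nat.sub_zero, zero_add, pow_one]
    field_simp

/-- Differentiating the kernel lowers `p` or `q` by one, so a double induction with one integration
by parts per step reduces the coefficients to Pascal's rule. The binomials are the `j`-th
derivatives of the kernel at the endpoints: only terms differentiating `(T - s)^p` exactly `p` times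
survive at `T`, and `s^q` exactly `q` times at `0`. -/
lemma integral_betaKernel_mul_cexp (p q : ℕ) (T : ℝ) {z : ℂ} (hz : z ≠ 0) :
    ∫ s in (0 : ℝ)..T, (betaKernel p q T s : ℂ) * Complex.exp (z * s) =
      betaExp p q T z (Complex.exp (z * T)) := by
  induction p generalizing q with
  | zero =>
    induction q with
    | zero =>
      refine mul_left_cancel₀ hz ?_
      rw [mul_integral_mul_cexp (hasDerivAt_betaKernel_zero_zero T) continuous_const,
        mul_betaExp _ _ _ hz]
      simp [betaKernel]
    | succ q ih =>
      refine mul_left_cancel₀ hz ?_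
      rw [mul_integral_mul_cexp (hasDerivAt_betaKernel_zero_succ q T) (continuous_betaKernel _ _ _),
        ih, mul_betaExp _ _ _ hz, betaExp, sub_eq_add_neg, ← Finset.sum_neg_distrib, add_comm]
      congr 1
      · refine Finset.sum_congr (by ring_nf) fun j hj => ?_
        have e : 0 + (q + 1) - (j + 1) = 0 + q - j := by omega
        have h0 : j.choose (q + 1) = 0 := Nat.choose_eq_zero_of_lt (by
          have := Finset.mem_range.1 hj; omega)
        rw [e, Nat.choose_succ_succ, h0]
        simp only [Nat.choose_zero_right]
        push_cast
        ring
      · simp [betaKernel]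
  | succ p ihp =>
    induction q with
    | zero =>
      refine mul_left_cancel₀ hz ?_
      rw [mul_integral_mul_cexp (hasDerivAt_betaKernel_succ_zero p T)
        (continuous_betaKernel _ _ _).neg, mul_betaExp _ _ _ hz]
      simp only [Complex.ofReal_neg, neg_mul]
      rw [intervalIntegral.integral_neg, ihp, betaExp, sub_neg_eq_add, add_comm]
      congr 1
      · refine Finset.sum_congr (by ring_nf) fun j hj => ?_
        have e : p + 1 + 0 - (j + 1) = p + 0 - j := by omega
        have h0 : j.choose (p + 1) = 0 := Nat.choose_eq_zero_of_lt (by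
          have := Finset.mem_range.1 hj; omega)
        rw [e, Nat.choose_succ_succ, h0]
        simp only [Nat.choose_zero_right]
        push_cast
        ring
      · simp [betaKernel]
    | succ q ihq =>
      refine mul_left_cancel₀ hz ?_
      rw [mul_integral_mul_cexp (hasDerivAt_betaKernel_succ_succ p q T)
        ((continuous_betaKernel _ _ _).sub (continuous_betaKernel _ _ _)), mul_betaExp _ _ _ hz]
      simp only [Complex.ofReal_sub, sub_mul]
      have c : ∀ p q, Continuous fun s : ℝ => (betaKernel p q T s : ℂ) * Complex.exp (z * s) :=
        fun p q => (Complex.continuous_ofReal.comp (continuous_betaKernel p q T)).mul (by fun_prop)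
      rw [intervalIntegral.integral_sub ((c _ _).intervalIntegrable _ _)
        ((c _ _).intervalIntegrable _ _), ihp, ihq, betaExp, betaExp]
      have e1 : p + 1 + q + 1 = p + 1 + (q + 1) := by omega
      have e2 : p + (q + 1) + 1 = p + 1 + (q + 1) := by omega
      rw [e1, e2, ← Finset.sum_sub_distrib, sub_eq_add_neg, ← Finset.sum_neg_distrib, add_comm]
      congr 1
      · refine Finset.sum_congr rfl fun j hj => ?_
        have e3 : p + 1 + (q + 1) - (j + 1) = p + 1 + q - j := by omega
        have e4 : p + (q + 1) - j = p + 1 + q - j := by omega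
        rw [e3, e4, Nat.choose_succ_succ, Nat.choose_succ_succ]
        push_cast
        ring
      · simp [betaKernel]

/-! ### Abel summation of the sine series -/

/-- Twice the imaginary part of the geometric series in `ρ exp (i s)`. -/
lemma hasSum_two_mul_pow_mul_sin {ρ : ℝ} (hρ : |ρ| < 1) (s : ℝ) :
    HasSum (fun n : ℕ => 2 * ρ ^ n * Real.sin (n * s))
      (2 * ρ * Real.sin s / (1 - 2 * ρ * Real.cos s + ρ ^ 2)) := by
  set z : ℂ := ρ * Complex.exp (s * Complex.I) with hz
  have hn : ‖z‖ < 1 := by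
    rw [hz, norm_mul, Complex.norm_exp_ofReal_mul_I, mul_one, Complex.norm_real]
    exact hρ
  have h := (Complex.hasSum_im (hasSum_geometric_of_norm_lt_one hn)).mul_left 2
  have hzre : z.re = ρ * Real.cos s := by
    rw [hz, Complex.re_ofReal_mul, Complex.exp_ofReal_mul_I_re]
  have hzim : z.im = ρ * Real.sin s := by
    rw [hz, Complex.im_ofReal_mul, Complex.exp_ofReal_mul_I_im]
  have e1 : 2 * ((1 - z)⁻¹).im = 2 * ρ * Real.sin s / (1 - 2 * ρ * Real.cos s + ρ ^ 2) := by
    rw [Complex.inv_im, Complex.normSq_apply]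
    simp only [Complex.sub_re, Complex.sub_im, Complex.one_re, Complex.one_im, hzre, hzim]
    have := Real.sin_sq_add_cos_sq s
    have e : (1 - ρ * Real.cos s) * (1 - ρ * Real.cos s) +
        (0 - ρ * Real.sin s) * (0 - ρ * Real.sin s) = 1 - 2 * ρ * Real.cos s + ρ ^ 2 := by
      linear_combination ρ ^ 2 * this
    rw [e]
    ring
  rw [e1] at h
  refine h.congr_fun fun n => Eq.symm ?_
  rw [hz, mul_pow, ← Complex.exp_nat_mul, ← Complex.ofReal_pow, Complex.im_ofReal_mul]
  have : (n : ℂ) * (s * Complex.I) = ((n * s : ℝ) : ℂ) * Complex.I := by push_cast; ring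
  rw [this, Complex.exp_ofReal_mul_I_im]
  ring

lemma hasSum_integral_mul_sin {P : ℝ → ℝ} (hP : Continuous P) {ρ : ℝ} (hρ : |ρ| < 1) {T : ℝ}
    (hT : 0 ≤ T) :
    HasSum (fun n : ℕ => 2 * ρ ^ n * ∫ s in (0 : ℝ)..T, P s * Real.sin (n * s))
      (∫ s in (0 : ℝ)..T, P s *
        (2 * ρ * Real.sin s / (1 - 2 * ρ * Real.cos s + ρ ^ 2))) := by
  obtain ⟨C, hC⟩ := (isCompact_Icc (a := (0 : ℝ)) (b := T)).exists_bound_of_continuousOn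
    hP.continuousOn
  have h := intervalIntegral.hasSum_integral_of_dominated_convergence (μ := volume) (a := 0) (b := T)
    (F := fun (n : ℕ) s => P s * (2 * ρ ^ n * Real.sin (n * s)))
    (f := fun s => P s * (2 * ρ * Real.sin s / (1 - 2 * ρ * Real.cos s + ρ ^ 2)))
    (fun n _ => C * (2 * |ρ| ^ n)) (fun n => (by fun_prop : Continuous fun s =>
      P s * (2 * ρ ^ n * Real.sin (n * s))).aestronglyMeasurable)
    (fun n => ae_of_all _ fun s hs => ?_)
    (ae_of_all _ fun s _ => ((summable_geometric_of_lt_one (abs_nonneg _) hρ).mul_left 2).mul_left C)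
    (by simp) (ae_of_all _ fun s _ => (hasSum_two_mul_pow_mul_sin hρ s).mul_left _)
  · refine h.congr_fun fun n => Eq.symm ?_
    rw [← intervalIntegral.integral_const_mul]
    refine intervalIntegral.integral_congr fun s _ => ?_
    ring
  · rw [uIoc_of_le hT] at hs
    rw [norm_mul]
    refine mul_le_mul (hC s (Ioc_subset_Icc_self hs)) ?_ (norm_nonneg _)
      ((norm_nonneg _).trans (hC s (Ioc_subset_Icc_self hs)))
    rw [Real.norm_eq_abs, abs_mul, abs_mul, abs_pow, abs_two]
    exact mul_le_of_le_one_right (by positivity) (Real.abs_sin_le_one _)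

/-- The pair `(x, y)` is `(cos, sin)` or `(sin, cos)` of `s/2`, which treats cot and tan together:
the denominator `1 ∓ 2 r cos s + r²` equals `(1 - r)² + 4 r y²`. The limit integrand itself
dominates. -/
lemma tendsto_integral_abel {P x y : ℝ → ℝ} {T : ℝ} (hT : 0 ≤ T) (hP : Continuous P)
    (hx : Continuous x) (hy : Continuous y) (hx0 : ∀ s ∈ Ioc 0 T, 0 ≤ x s)
    (hy0 : ∀ s ∈ Ioc 0 T, 0 < y s)
    (hi : IntervalIntegrable (fun s => P s * (x s / y s)) volume 0 T) :
    Tendsto (fun r : ℝ => ∫ s in (0 : ℝ)..T,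
        P s * (4 * r * x s * y s / ((1 - r) ^ 2 + 4 * r * y s ^ 2)))
      (𝓝[<] 1) (𝓝 (∫ s in (0 : ℝ)..T, P s * (x s / y s))) := by
  have hr : ∀ᶠ r : ℝ in 𝓝[<] 1, 0 < r ∧ r < 1 := by
    filter_upwards [Ioo_mem_nhdsLT (show (0 : ℝ) < 1 by norm_num)] with r hr using hr
  refine intervalIntegral.tendsto_integral_filter_of_dominated_convergence
    (fun s => ‖P s * (x s / y s)‖) ?_ ?_ hi.norm ?_
  · refine Eventually.of_forall fun r => Measurable.aestronglyMeasurable ?_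
    exact hP.measurable.mul (Measurable.div (by fun_prop) (by fun_prop))
  · filter_upwards [hr] with r hr
    refine ae_of_all _ fun s hs => ?_
    rw [uIoc_of_le hT] at hs
    have hxs := hx0 s hs
    have hys := hy0 s hs
    have h1 := hr.1
    rw [norm_mul, norm_mul]
    refine mul_le_mul_of_nonneg_left ?_ (norm_nonneg _)
    rw [Real.norm_of_nonneg (by positivity), Real.norm_of_nonneg (by positivity),
      div_le_div_iff₀ (by positivity) hys]
    -- After clearing denominators the two sides differ by exactly `x (1 - r)²`.
    nlinarith [mul_nonneg hxs (sq_nonneg (1 - r))]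
  · refine ae_of_all _ fun s hs => ?_
    rw [uIoc_of_le hT] at hs
    have hys := hy0 s hs
    have hc : ContinuousAt (fun r : ℝ => P s * (4 * r * x s * y s / ((1 - r) ^ 2 + 4 * r * y s ^ 2)))
        1 := by
      refine ContinuousAt.mul continuousAt_const (ContinuousAt.div (by fun_prop) (by fun_prop) ?_)
      have : 0 < (1 - (1 : ℝ)) ^ 2 + 4 * 1 * y s ^ 2 := by positivity
      exact this.ne'
    have h := hc.tendsto.mono_left (nhdsWithin_le_nhds (s := Iio 1))
    convert h using 2
    field_simp
    ring

/-! ### Polylogarithms and their boundary values -/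

/-- The polylogarithm `∑ zⁿ / n^s`. -/
noncomputable def polylog (s : ℕ) (z : ℂ) : ℂ := ∑' n : ℕ, z ^ n / (n : ℂ) ^ s

lemma norm_polylog_term_le {z : ℂ} (hz : ‖z‖ ≤ 1) (s n : ℕ) :
    ‖z ^ n / (n : ℂ) ^ s‖ ≤ ((n : ℝ) ^ s)⁻¹ := by
  rw [norm_div, norm_pow, norm_pow, Complex.norm_natCast, div_eq_mul_inv]
  exact mul_le_of_le_one_left (by positivity) (pow_le_one₀ (norm_nonneg _) hz)

lemma summable_polylog_of_two_le {z : ℂ} (hz : ‖z‖ ≤ 1) {s : ℕ} (hs : 2 ≤ s) :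
    Summable fun n : ℕ => z ^ n / (n : ℂ) ^ s :=
  Summable.of_norm_bounded (Real.summable_nat_pow_inv.2 hs) (norm_polylog_term_le hz s)

lemma summable_polylog_of_norm_lt_one {z : ℂ} (hz : ‖z‖ < 1) (s : ℕ) :
    Summable fun n : ℕ => z ^ n / (n : ℂ) ^ s := by
  refine Summable.of_norm_bounded (summable_geometric_of_lt_one (norm_nonneg _) hz) fun n => ?_
  rw [norm_div, norm_pow, norm_pow, Complex.norm_natCast]
  rcases n with _ | n
  · rcases s with _ | s <;> simp
  · exact div_le_self (by positivity) (one_le_pow₀ (by push_cast; linarith [n.cast_nonneg (α := ℝ)]))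

/-- The boundary value of the polylogarithm on the unit circle. -/
noncomputable def polylogBoundary (s : ℕ) (w : ℂ) : ℂ :=
  if s = 1 then -Complex.log (1 - w) else polylog s w

/-- From order 2 on, `∑ n^(-s)` dominates. In order 1 absolute convergence fails on the circle, and
continuity of the logarithm at `1 - w` replaces it. -/
lemma tendsto_polylog {s : ℕ} (hs : 1 ≤ s) {w : ℂ} (hw : ‖w‖ = 1)
    (h1 : s = 1 → 1 - w ∈ Complex.slitPlane) :
    Tendsto (fun r : ℝ => polylog s (r * w)) (𝓝[<] 1) (𝓝 (polylogBoundary s w)) := by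
  have hr : ∀ᶠ r : ℝ in 𝓝[<] 1, 0 < r ∧ r < 1 := by
    filter_upwards [Ioo_mem_nhdsLT (show (0 : ℝ) < 1 by norm_num)] with r hr using hr
  have hnorm : ∀ r : ℝ, 0 < r → ‖(r : ℂ) * w‖ = r := fun r h0 => by
    rw [norm_mul, hw, mul_one, Complex.norm_real, Real.norm_of_nonneg h0.le]
  unfold polylogBoundary
  split_ifs with h
  · have hc : ContinuousAt (fun r : ℝ => -Complex.log (1 - r * w)) 1 := by
      refine (ContinuousAt.clog (by fun_prop) ?_).neg
      simpa using h1 h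
    have := hc.tendsto.mono_left (nhdsWithin_le_nhds (s := Iio 1))
    simp only [Complex.ofReal_one, one_mul] at this
    refine this.congr' ?_
    filter_upwards [hr] with r hr
    have := (Complex.hasSum_taylorSeries_neg_log (z := r * w) (by rw [hnorm r hr.1]; exact hr.2)).tsum_eq
    rw [← this, polylog, h]
    simp
  · refine tendsto_tsum_of_dominated_convergence
      (Real.summable_nat_pow_inv.2 (show 1 < s by omega)) (fun n => ?_) ?_
    · have hc : ContinuousAt (fun r : ℝ => ((r : ℂ) * w) ^ n / (n : ℂ) ^ s) 1 := by fun_prop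
      simpa using hc.tendsto.mono_left (nhdsWithin_le_nhds (s := Iio 1))
    · filter_upwards [hr] with r hr n
      exact norm_polylog_term_le (by rw [hnorm r hr.1]; exact hr.2.le) s n

/-- The sum over `j` that evaluates `∑ 2 ρⁿ ∫₀ᵀ (T - s)^p / p! * s^q / q! * sin (n s) ds`, where
`L` and `M` are the values of the polylogarithms at `ρ exp (i T)` and `ρ`. -/
noncomputable def polylogSum (p q : ℕ) (T : ℝ) (L M : ℕ → ℂ) : ℂ :=
  ∑ j ∈ Finset.range (p + q + 1), (T : ℂ) ^ (p + q - j) / ((p + q - j).factorial : ℂ) *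
    (2 * (-Complex.I) ^ (j + 1)) *
      ((-1) ^ (j + p) * (j.choose p : ℂ) * L (j + 1) - (-1) ^ q * (j.choose q : ℂ) * M (j + 1))

lemma integral_betaKernel_mul_sin (p q : ℕ) (T : ℝ) (n : ℕ) :
    ∫ s in (0 : ℝ)..T, betaKernel p q T s * Real.sin (n * s) =
      (∫ s in (0 : ℝ)..T, (betaKernel p q T s : ℂ) * Complex.exp ((n * Complex.I) * s)).im := by
  have c : Continuous fun s : ℝ =>
      (betaKernel p q T s : ℂ) * Complex.exp ((n * Complex.I) * s) :=
    (Complex.continuous_ofReal.comp (continuous_betaKernel p q T)).mul (by fun_prop)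
  have h := Complex.imCLM.intervalIntegral_comp_comm (c.intervalIntegrable (μ := volume) 0 T)
  simp only [Complex.imCLM_apply] at h
  rw [← h]
  refine intervalIntegral.integral_congr fun s _ => ?_
  have e : (n : ℂ) * Complex.I * s = ((n * s : ℝ) : ℂ) * Complex.I := by push_cast; ring
  rw [Complex.im_ofReal_mul, e, Complex.exp_ofReal_mul_I_im]

lemma hasSum_polylogSum (p q : ℕ) (T : ℝ) {ρ : ℝ} (hρ : |ρ| < 1) :
    HasSum (fun n : ℕ => 2 * ρ ^ n * ∫ s in (0 : ℝ)..T, betaKernel p q T s * Real.sin (n * s))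
      (polylogSum p q T (fun s => polylog s (ρ * Complex.exp (T * Complex.I)))
        (fun s => polylog s ρ)).im := by
  have hn1 : ‖(ρ : ℂ) * Complex.exp (T * Complex.I)‖ < 1 := by
    rw [norm_mul, Complex.norm_exp_ofReal_mul_I, mul_one, Complex.norm_real]
    exact hρ
  have hn2 : ‖(ρ : ℂ)‖ < 1 := by rw [Complex.norm_real]; exact hρ
  have h : HasSum (fun n : ℕ => polylogSum p q T
      (fun s => ((ρ : ℂ) * Complex.exp (T * Complex.I)) ^ n / (n : ℂ) ^ s)
      (fun s => (ρ : ℂ) ^ n / (n : ℂ) ^ s))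
      (polylogSum p q T (fun s => polylog s (ρ * Complex.exp (T * Complex.I)))
        (fun s => polylog s ρ)) :=
    hasSum_sum fun j _ => (((summable_polylog_of_norm_lt_one hn1 (j + 1)).hasSum.mul_left _).sub
      ((summable_polylog_of_norm_lt_one hn2 (j + 1)).hasSum.mul_left _)).mul_left _
  refine (Complex.hasSum_im h).congr_fun fun n => Eq.symm ?_
  rcases Nat.eq_zero_or_pos n with rfl | hn
  -- The index `n = 0` contributes nothing on either side: `sin 0 = 0`, and division by `0 ^ (j +
  -- 1)` gives `0`.
  · simp [polylogSum]
  · have hz : (n : ℂ) * Complex.I ≠ 0 :=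
      mul_ne_zero (Nat.cast_ne_zero.2 hn.ne') Complex.I_ne_zero
    have e : (2 * ρ ^ n * (betaExp p q T (n * Complex.I)
        (Complex.exp (n * Complex.I * T))).im : ℝ) =
        (((2 * ρ ^ n : ℝ) : ℂ) * betaExp p q T (n * Complex.I)
          (Complex.exp (n * Complex.I * T))).im := by rw [Complex.im_ofReal_mul]
    rw [integral_betaKernel_mul_sin, integral_betaKernel_mul_cexp p q T hz, e]
    congr 1
    have e2 : Complex.exp (n * Complex.I * T) = Complex.exp (T * Complex.I) ^ n := by
      rw [← Complex.exp_nat_mul]; congr 1; ring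
    have e3 : ((n : ℂ) * Complex.I)⁻¹ = -Complex.I * (n : ℂ)⁻¹ := by
      rw [mul_inv, Complex.inv_I]; ring
    rw [polylogSum, betaExp, Finset.mul_sum, e2, e3]
    refine Finset.sum_congr rfl fun j _ => ?_
    rw [mul_pow, mul_pow]
    push_cast
    ring

/-- Order 1 occurs only for `j = 0`, with coefficient `binom(0, p)` or `binom(0, q)`. The logarithm
therefore needs control only when that exponent is zero. -/
lemma tendsto_polylogSum {p q : ℕ} (T : ℝ) {w u : ℂ} (hw : ‖w‖ = 1) (hu : ‖u‖ = 1)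
    (h1 : p = 0 → 1 - w ∈ Complex.slitPlane) (h2 : q = 0 → 1 - u ∈ Complex.slitPlane) :
    Tendsto (fun r : ℝ => polylogSum p q T (fun s => polylog s (r * w)) (fun s => polylog s (r * u)))
      (𝓝[<] 1) (𝓝 (polylogSum p q T (fun s => polylogBoundary s w)
        (fun s => polylogBoundary s u))) := by
  have key : ∀ (p j : ℕ) (w : ℂ), ‖w‖ = 1 → (p = 0 → 1 - w ∈ Complex.slitPlane) → ∀ c : ℂ,
      Tendsto (fun r : ℝ => c * (j.choose p : ℂ) * polylog (j + 1) (r * w)) (𝓝[<] 1)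
        (𝓝 (c * (j.choose p : ℂ) * polylogBoundary (j + 1) w)) := by
    intro p j w hw h c
    by_cases hj : j.choose p = 0
    · simp [hj]
    · refine (tendsto_polylog (Nat.succ_pos j) hw fun hs => h ?_).const_mul _
      obtain rfl : j = 0 := by omega
      by_contra hp
      exact hj (Nat.choose_eq_zero_of_lt (Nat.pos_of_ne_zero hp))
  exact tendsto_finsetSum _ fun j _ => ((key p j w hw h1 _).sub (key q j u hu h2 _)).const_mul _

lemma eventually_Ioo_nhdsLT_one : ∀ᶠ r : ℝ in 𝓝[<] 1, 0 < r ∧ r < 1 := by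
  filter_upwards [Ioo_mem_nhdsLT (show (0 : ℝ) < 1 by norm_num)] with r hr using hr

lemma one_sub_exp_mem_slitPlane :
    1 - Complex.exp ((Real.pi / 3 : ℝ) * Complex.I) ∈ Complex.slitPlane := by
  refine Or.inl ?_
  rw [Complex.sub_re, Complex.exp_ofReal_mul_I_re, Real.cos_pi_div_three]
  norm_num

/-- The condition on `q` serves twice: it makes the integrand integrable at `0`, and it removes the
divergent order-1 polylogarithm at `1`. -/
theorem integral_betaKernel_mul_cot (p : ℕ) {q : ℕ} (hq : 1 ≤ q) :
    ∫ s in (0 : ℝ)..(Real.pi / 3), betaKernel p q (Real.pi / 3) s *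
        (Real.cos (s / 2) / Real.sin (s / 2)) =
      (polylogSum p q (Real.pi / 3)
        (fun s => polylogBoundary s (Complex.exp ((Real.pi / 3 : ℝ) * Complex.I)))
        (fun s => polylogBoundary s 1)).im := by
  have hT : 0 ≤ Real.pi / 3 := by positivity
  have hy : ∀ s ∈ Ioc 0 (Real.pi / 3), 0 < Real.sin (s / 2) := fun s hs =>
    Real.sin_pos_of_pos_of_lt_pi (by linarith [hs.1]) (by linarith [hs.2, Real.pi_pos])
  have hx : ∀ s ∈ Ioc 0 (Real.pi / 3), 0 ≤ Real.cos (s / 2) := fun s hs =>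
    (cos_half_pos (Icc_pi_div_three_mono pi_div_three_mem hs)).le
  have l1 := tendsto_integral_abel hT (continuous_betaKernel p q (Real.pi / 3))
    (by fun_prop : Continuous fun s : ℝ => Real.cos (s / 2))
    (by fun_prop : Continuous fun s : ℝ => Real.sin (s / 2)) hx hy
    (intervalIntegrable_betaKernel_mul_cot p hq)
  have l2 := (Complex.continuous_im.tendsto _).comp (tendsto_polylogSum (p := p) (q := q)
    (Real.pi / 3) (Complex.norm_exp_ofReal_mul_I (Real.pi / 3)) norm_one
    (fun _ => one_sub_exp_mem_slitPlane) (fun h => by omega))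
  refine tendsto_nhds_unique l1 (l2.congr' ?_)
  filter_upwards [eventually_Ioo_nhdsLT_one] with r hr
  have hr1 : |r| < 1 := by rw [abs_of_pos hr.1]; exact hr.2
  have := (hasSum_polylogSum p q (Real.pi / 3) hr1).unique
    (hasSum_integral_mul_sin (continuous_betaKernel p q (Real.pi / 3)) hr1 hT)
  simp only [Function.comp_apply, mul_one]
  rw [this]
  refine intervalIntegral.integral_congr fun s _ => ?_
  have e1 : Real.sin s = 2 * Real.sin (s / 2) * Real.cos (s / 2) := by
    rw [← Real.sin_two_mul]; congr 1; ring
  have e2 : Real.cos s = 1 - 2 * Real.sin (s / 2) ^ 2 := by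
    have h := Real.cos_two_mul (s / 2)
    have h2 := Real.sin_sq_add_cos_sq (s / 2)
    rw [show 2 * (s / 2) = s by ring] at h
    linarith
  rw [e1, e2]
  congr 2 <;> ring

/-- The sine series is taken at `ρ = -r`, so the boundary points are the negatives of those for the
cotangent. -/
theorem integral_betaKernel_mul_tan {p q : ℕ} (hp : 1 ≤ p) :
    ∫ s in (0 : ℝ)..(Real.pi / 3), betaKernel p q (Real.pi / 3) s *
        (Real.sin (s / 2) / Real.cos (s / 2)) =
      -(polylogSum p q (Real.pi / 3)
        (fun s => polylogBoundary s (-Complex.exp ((Real.pi / 3 : ℝ) * Complex.I)))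
        (fun s => polylogBoundary s (-1))).im := by
  have hT : 0 ≤ Real.pi / 3 := by positivity
  have hy : ∀ s ∈ Ioc 0 (Real.pi / 3), 0 < Real.cos (s / 2) := fun s hs =>
    cos_half_pos (Icc_pi_div_three_mono pi_div_three_mem hs)
  have hx : ∀ s ∈ Ioc 0 (Real.pi / 3), 0 ≤ Real.sin (s / 2) := fun s hs =>
    sin_half_nonneg (Icc_pi_div_three_mono pi_div_three_mem hs)
  have l1 := tendsto_integral_abel hT (continuous_betaKernel p q (Real.pi / 3))
    (by fun_prop : Continuous fun s : ℝ => Real.sin (s / 2))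
    (by fun_prop : Continuous fun s : ℝ => Real.cos (s / 2)) hx hy
    (intervalIntegrable_betaKernel_mul_tan p q)
  have l2 := ((Complex.continuous_im.tendsto _).comp (tendsto_polylogSum (p := p) (q := q)
    (Real.pi / 3) (w := -Complex.exp ((Real.pi / 3 : ℝ) * Complex.I)) (u := -1)
    (by rw [norm_neg, Complex.norm_exp_ofReal_mul_I]) (by simp)
    (fun h => by omega) (fun _ => Or.inl (by norm_num)))).neg
  refine tendsto_nhds_unique l1 (l2.congr' ?_)
  filter_upwards [eventually_Ioo_nhdsLT_one] with r hr
  have hr1 : |-r| < 1 := by rw [abs_neg, abs_of_pos hr.1]; exact hr.2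
  have := (hasSum_polylogSum p q (Real.pi / 3) hr1).unique
    (hasSum_integral_mul_sin (continuous_betaKernel p q (Real.pi / 3)) hr1 hT)
  simp only [Complex.ofReal_neg, neg_mul] at this
  simp only [Function.comp_apply, mul_one, mul_neg]
  rw [this, ← intervalIntegral.integral_neg]
  refine intervalIntegral.integral_congr fun s _ => ?_
  have e1 : Real.sin s = 2 * Real.sin (s / 2) * Real.cos (s / 2) := by
    rw [← Real.sin_two_mul]; congr 1; ring
  have e2 : Real.cos s = 2 * Real.cos (s / 2) ^ 2 - 1 := by
    rw [← Real.cos_two_mul]; congr 1; ring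
  rw [e1, e2, ← mul_neg, ← neg_div]
  congr 2 <;> ring

/-! ### Dirichlet series of period 3, zeta and `L(s, χ)` -/

/-- The real Dirichlet series `∑ g(n) / n^s`. -/
noncomputable def realDirichlet (g : ℕ → ℝ) (s : ℕ) : ℝ := ∑' n : ℕ, g n / (n : ℝ) ^ s

lemma summable_realDirichlet {g : ℕ → ℝ} (hg : ∀ n, |g n| ≤ 1) {s : ℕ} (hs : 2 ≤ s) :
    Summable fun n : ℕ => g n / (n : ℝ) ^ s := by
  refine Summable.of_norm_bounded (Real.summable_nat_pow_inv.2 hs) fun n => ?_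
  rw [norm_div, Real.norm_eq_abs, div_eq_mul_inv, norm_pow, Real.norm_natCast]
  exact mul_le_of_le_one_left (by positivity) (hg n)

lemma tsum_ite_dvd_div_pow {g : ℕ → ℝ} {d : ℕ} (hd : d ≠ 0) {ε : ℝ}
    (he : ∀ m, g (d * m) = ε * g m) (s : ℕ) :
    ∑' n : ℕ, (if d ∣ n then g n else 0) / (n : ℝ) ^ s =
      ε / (d : ℝ) ^ s * realDirichlet g s := by
  have hinj : Function.Injective fun m : ℕ => d * m := fun a b h =>
    Nat.eq_of_mul_eq_mul_left (Nat.pos_of_ne_zero hd) h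
  rw [← hinj.tsum_eq, realDirichlet, ← tsum_mul_left]
  · refine tsum_congr fun m => ?_
    rw [if_pos (Dvd.intro m rfl), he]
    push_cast
    rw [mul_pow, mul_div_mul_comm]
  · intro n hn
    by_contra h
    refine hn ?_
    have : ¬ d ∣ n := fun ⟨m, hm⟩ => h ⟨m, hm.symm⟩
    simp [this]

/-- Write `(-1)^n` as twice the indicator of even `n`, minus one; on even `n` the relation for `g (2
* m)` extracts the factor `ε / 2^s`. -/
lemma realDirichlet_neg_one_pow_mul {g : ℕ → ℝ} (hg : ∀ n, |g n| ≤ 1) {ε : ℝ}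
    (he : ∀ m, g (2 * m) = ε * g m) {s : ℕ} (hs : 2 ≤ s) :
    realDirichlet (fun n => (-1) ^ n * g n) s = (2 * ε / 2 ^ s - 1) * realDirichlet g s := by
  have h1 : Summable fun n : ℕ => (if 2 ∣ n then g n else 0) / (n : ℝ) ^ s := by
    refine summable_realDirichlet (fun n => ?_) hs
    split_ifs
    · exact hg n
    · simp
  have h2 := tsum_ite_dvd_div_pow two_ne_zero he s
  push_cast at h2
  have : realDirichlet (fun n => (-1) ^ n * g n) s =
      ∑' n : ℕ, (2 * ((if 2 ∣ n then g n else 0) / (n : ℝ) ^ s) - g n / (n : ℝ) ^ s) := by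
    refine tsum_congr fun n => ?_
    beta_reduce
    split_ifs with h
    · rw [(even_iff_two_dvd.2 h).neg_one_pow]; ring
    · rw [(Nat.not_even_iff_odd.1 fun h' => h h'.two_dvd).neg_one_pow]; ring
  rw [this, (h1.mul_left 2).tsum_sub (summable_realDirichlet hg hs), tsum_mul_left, h2,
    realDirichlet]
  ring

/-- The non-principal character modulo `3`, with real values. -/
def chiThree (n : ℕ) : ℝ := if n % 3 = 1 then 1 else if n % 3 = 2 then -1 else 0

/-- The real part of the powers of a primitive cube root of unity. -/
noncomputable def cosThree (n : ℕ) : ℝ := if 3 ∣ n then 1 else -1 / 2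

lemma abs_chiThree_le (n : ℕ) : |chiThree n| ≤ 1 := by
  unfold chiThree; split_ifs <;> simp

lemma abs_cosThree_le (n : ℕ) : |cosThree n| ≤ 1 := by
  unfold cosThree; split_ifs <;> norm_num [abs_of_neg, abs_div]

lemma chiThree_two_mul (m : ℕ) : chiThree (2 * m) = -1 * chiThree m := by
  have h : m % 3 = 0 ∨ m % 3 = 1 ∨ m % 3 = 2 := by omega
  unfold chiThree
  rcases h with h | h | h <;> norm_num [Nat.mul_mod, h]

lemma cosThree_two_mul (m : ℕ) : cosThree (2 * m) = 1 * cosThree m := by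
  have : 3 ∣ 2 * m ↔ 3 ∣ m := by omega
  simp [cosThree, this]

/-- `cosThree` is `3/2` times the indicator of multiples of 3, minus `1/2`. -/
lemma realDirichlet_cosThree {s : ℕ} (hs : 2 ≤ s) :
    realDirichlet cosThree s = -(1 / 2) * (1 - 3 / 3 ^ s) * realDirichlet (fun _ => 1) s := by
  have h0 := summable_realDirichlet (g := fun _ => 1) (by simp) hs
  have h1 : Summable fun n : ℕ => (if 3 ∣ n then (1 : ℝ) else 0) / (n : ℝ) ^ s := by
    refine summable_realDirichlet (fun n => ?_) hs
    split_ifs <;> simp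
  have h2 := tsum_ite_dvd_div_pow (g := fun _ => 1) three_ne_zero (ε := 1) (by simp) s
  push_cast at h2
  have : realDirichlet cosThree s =
      ∑' n : ℕ, (3 / 2 * ((if 3 ∣ n then (1 : ℝ) else 0) / (n : ℝ) ^ s) -
        1 / 2 * (1 / (n : ℝ) ^ s)) := by
    refine tsum_congr fun n => ?_
    unfold cosThree
    split_ifs <;> ring
  rw [this, (h1.mul_left _).tsum_sub (h0.mul_left _), tsum_mul_left, tsum_mul_left, h2,
    realDirichlet]
  ring

lemma riemannZeta_eq_realDirichlet {k : ℕ} (hk : 2 ≤ k) :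
    riemannZeta k = ((realDirichlet (fun _ => 1) k : ℝ) : ℂ) := by
  rw [zeta_nat_eq_tsum_of_gt_one hk, realDirichlet, Complex.ofReal_tsum]
  exact tsum_congr fun n => by push_cast; rfl

lemma dirichletCharacter_three_apply {χ : DirichletCharacter ℂ 3} (hχ : χ ≠ 1) (n : ℕ) :
    χ (n : ZMod 3) = ((chiThree n : ℝ) : ℂ) := by
  -- The square of 2 is 1 modulo 3, so `χ 2 = ±1`, and the value 1 would make `χ` principal.
  have h2 : χ 2 = -1 := by
    have hsq : χ 2 * χ 2 = 1 := by
      rw [← map_mul, show (2 : ZMod 3) * 2 = 1 by decide, map_one]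
    rcases mul_self_eq_one_iff.1 hsq with h | h
    · refine absurd (MulChar.ext' fun a => ?_) hχ
      have ha : a = 0 ∨ a = 1 ∨ a = 2 := by revert a; decide
      have hu : IsUnit (2 : ZMod 3) := by decide
      rcases ha with rfl | rfl | rfl
      · rw [MulChar.map_nonunit _ (by simp), MulChar.map_nonunit _ (by simp)]
      · simp
      · rw [h, MulChar.one_apply hu]
    · exact h
  have hn : (n : ZMod 3) = ((n % 3 : ℕ) : ZMod 3) := by simp
  rw [hn]
  have h : n % 3 = 0 ∨ n % 3 = 1 ∨ n % 3 = 2 := by omega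
  unfold chiThree
  rcases h with h | h | h
  · rw [h]
    simpa using MulChar.map_nonunit χ (a := 0) (by simp)
  · rw [h]; simp
  · rw [h]; simpa using h2

lemma LFunction_eq_realDirichlet {χ : DirichletCharacter ℂ 3} (hχ : χ ≠ 1) {k : ℕ} (hk : 2 ≤ k) :
    DirichletCharacter.LFunction χ k = ((realDirichlet chiThree k : ℝ) : ℂ) := by
  rw [DirichletCharacter.LFunction_eq_LSeries χ (by
    rw [Complex.natCast_re]; exact_mod_cast hk), realDirichlet, Complex.ofReal_tsum, LSeries]
  refine tsum_congr fun n => ?_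
  rcases eq_or_ne n 0 with rfl | hn
  · simp [chiThree]
  · rw [LSeries.term_of_ne_zero hn, dirichletCharacter_three_apply hχ, Complex.cpow_natCast]
    push_cast
    rfl

/-! ### Polylogarithm values at the relevant roots of unity -/

lemma neg_exp_pi_div_three :
    -Complex.exp ((Real.pi / 3 : ℝ) * Complex.I) = ⟨-1 / 2, -(Real.sqrt 3 / 2)⟩ := by
  apply Complex.ext
  · rw [Complex.neg_re, Complex.exp_ofReal_mul_I_re, Real.cos_pi_div_three]; norm_num
  · rw [Complex.neg_im, Complex.exp_ofReal_mul_I_im, Real.sin_pi_div_three]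

lemma neg_exp_pi_div_three_pow (n : ℕ) :
    (-Complex.exp ((Real.pi / 3 : ℝ) * Complex.I)) ^ n =
      ⟨cosThree n, -(Real.sqrt 3 / 2) * chiThree n⟩ := by
  have h3 : (-Complex.exp ((Real.pi / 3 : ℝ) * Complex.I)) ^ 3 = 1 := by
    rw [neg_pow, ← Complex.exp_nat_mul]
    have : ((3 : ℕ) : ℂ) * ((Real.pi / 3 : ℝ) * Complex.I) = Real.pi * Complex.I := by
      push_cast; ring
    rw [this, Complex.exp_pi_mul_I]
    norm_num
  have hs : Real.sqrt 3 * Real.sqrt 3 = 3 := Real.mul_self_sqrt (by norm_num)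
  rw [← Nat.mod_add_div n 3, pow_add, pow_mul, h3, one_pow, mul_one, neg_exp_pi_div_three]
  have hd : 3 ∣ n % 3 + 3 * (n / 3) ↔ n % 3 = 0 := by omega
  have hm : (n % 3 + 3 * (n / 3)) % 3 = n % 3 := by omega
  unfold cosThree chiThree
  rw [hm]
  simp only [hd]
  have h : n % 3 = 0 ∨ n % 3 = 1 ∨ n % 3 = 2 := by omega
  rcases h with h | h | h
  · rw [h]; apply Complex.ext <;> simp
  · rw [h]; apply Complex.ext <;> simp
  · rw [h, pow_two]
    apply Complex.ext
    · simp only [Complex.mul_re]; norm_num; nlinarith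
    · simp only [Complex.mul_im]; norm_num; nlinarith

lemma polylog_re {z : ℂ} (hz : ‖z‖ ≤ 1) {s : ℕ} (hs : 2 ≤ s) :
    (polylog s z).re = realDirichlet (fun n => (z ^ n).re) s := by
  rw [polylog, Complex.re_tsum (summable_polylog_of_two_le hz hs)]
  refine tsum_congr fun n => ?_
  rw [← Complex.ofReal_natCast, ← Complex.ofReal_pow, Complex.div_ofReal_re]

lemma polylog_im {z : ℂ} (hz : ‖z‖ ≤ 1) {s : ℕ} (hs : 2 ≤ s) :
    (polylog s z).im = realDirichlet (fun n => (z ^ n).im) s := by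
  rw [polylog, Complex.im_tsum (summable_polylog_of_two_le hz hs)]
  refine tsum_congr fun n => ?_
  rw [← Complex.ofReal_natCast, ← Complex.ofReal_pow, Complex.div_ofReal_im]

lemma realDirichlet_const_mul (c : ℝ) (g : ℕ → ℝ) (s : ℕ) :
    realDirichlet (fun n => c * g n) s = c * realDirichlet g s := by
  rw [realDirichlet, realDirichlet, ← tsum_mul_left]
  exact tsum_congr fun n => mul_div_assoc _ _ _

lemma norm_neg_exp_le : ‖-Complex.exp ((Real.pi / 3 : ℝ) * Complex.I)‖ ≤ 1 := by
  rw [norm_neg, Complex.norm_exp_ofReal_mul_I]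

lemma norm_exp_le : ‖Complex.exp ((Real.pi / 3 : ℝ) * Complex.I)‖ ≤ 1 := by
  rw [Complex.norm_exp_ofReal_mul_I]

/-- Reduces the sixth root of unity to the cube root at the cost of a sign `(-1)^n`, which produces
the Euler factors at 2. -/
lemma exp_pi_div_three_pow (n : ℕ) : Complex.exp ((Real.pi / 3 : ℝ) * Complex.I) ^ n =
    (((-1) ^ n : ℝ) : ℂ) * (-Complex.exp ((Real.pi / 3 : ℝ) * Complex.I)) ^ n := by
  rw [neg_pow (Complex.exp _), ← mul_assoc]
  push_cast
  rw [← mul_pow]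
  simp

lemma polylog_neg_exp_re {s : ℕ} (hs : 2 ≤ s) :
    (polylog s (-Complex.exp ((Real.pi / 3 : ℝ) * Complex.I))).re =
      -(1 / 2) * (1 - 3 / 3 ^ s) * realDirichlet (fun _ => 1) s := by
  rw [polylog_re norm_neg_exp_le hs, ← realDirichlet_cosThree hs]
  simp_rw [neg_exp_pi_div_three_pow]

lemma polylog_neg_exp_im {s : ℕ} (hs : 2 ≤ s) :
    (polylog s (-Complex.exp ((Real.pi / 3 : ℝ) * Complex.I))).im =
      -(Real.sqrt 3 / 2) * realDirichlet chiThree s := by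
  rw [polylog_im norm_neg_exp_le hs, ← realDirichlet_const_mul]
  simp_rw [neg_exp_pi_div_three_pow]

lemma polylog_exp_re {s : ℕ} (hs : 2 ≤ s) :
    (polylog s (Complex.exp ((Real.pi / 3 : ℝ) * Complex.I))).re =
      1 / 2 * (1 - 2 / 2 ^ s) * (1 - 3 / 3 ^ s) * realDirichlet (fun _ => 1) s := by
  rw [polylog_re norm_exp_le hs]
  simp_rw [exp_pi_div_three_pow, Complex.re_ofReal_mul, neg_exp_pi_div_three_pow]
  rw [realDirichlet_neg_one_pow_mul abs_cosThree_le cosThree_two_mul hs, realDirichlet_cosThree hs]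
  ring

lemma polylog_exp_im {s : ℕ} (hs : 2 ≤ s) :
    (polylog s (Complex.exp ((Real.pi / 3 : ℝ) * Complex.I))).im =
      Real.sqrt 3 / 2 * (1 + 2 / 2 ^ s) * realDirichlet chiThree s := by
  rw [polylog_im norm_exp_le hs]
  simp_rw [exp_pi_div_three_pow, Complex.im_ofReal_mul, neg_exp_pi_div_three_pow,
    mul_left_comm _ (-(Real.sqrt 3 / 2))]
  rw [realDirichlet_const_mul, realDirichlet_neg_one_pow_mul abs_chiThree_le chiThree_two_mul hs]
  ring

lemma polylog_one (s : ℕ) : polylog s 1 = ((realDirichlet (fun _ => 1) s : ℝ) : ℂ) := by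
  rw [polylog, realDirichlet, Complex.ofReal_tsum]
  exact tsum_congr fun n => by push_cast; rw [one_pow]

lemma polylog_neg_one {s : ℕ} (hs : 2 ≤ s) :
    polylog s (-1) = (((2 / 2 ^ s - 1) * realDirichlet (fun _ => 1) s : ℝ) : ℂ) := by
  have h := realDirichlet_neg_one_pow_mul (g := fun _ => 1) (by simp) (ε := 1) (by simp) hs
  rw [mul_one] at h
  rw [← h, polylog, realDirichlet, Complex.ofReal_tsum]
  exact tsum_congr fun n => by push_cast; rw [mul_one]

/-- `1 - exp (iπ/3)` lies on the unit circle. This removes the `r = 0` term from the sum that starts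
at `max a 1`. -/
lemma log_one_sub_exp_re :
    (-Complex.log (1 - Complex.exp ((Real.pi / 3 : ℝ) * Complex.I))).re = 0 := by
  have h : ‖1 - Complex.exp ((Real.pi / 3 : ℝ) * Complex.I)‖ = 1 := by
    rw [← sq_eq_sq₀ (norm_nonneg _) zero_le_one, Complex.sq_norm, Complex.normSq_apply,
      Complex.sub_re, Complex.sub_im, Complex.exp_ofReal_mul_I_re, Complex.exp_ofReal_mul_I_im,
      Real.cos_pi_div_three, Real.sin_pi_div_three]
    have hs : Real.sqrt 3 * Real.sqrt 3 = 3 := Real.mul_self_sqrt (by norm_num)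
    simp only [Complex.one_re, Complex.one_im]
    nlinarith
  rw [Complex.neg_re, Complex.log_re, h, Real.log_one, neg_zero]

/-! ### Taking imaginary parts and assembling the formulas -/

lemma sum_range_two_mul_add_one {α : Type*} [AddCommMonoid α] (f : ℕ → α) (M : ℕ) :
    ∑ j ∈ Finset.range (2 * M + 1), f j =
      ∑ r ∈ Finset.range (M + 1), f (2 * r) + ∑ r ∈ Finset.range M, f (2 * r + 1) := by
  induction M with
  | zero => simp
  | succ M ih =>
    rw [show 2 * (M + 1) + 1 = 2 * M + 1 + 1 + 1 by ring, Finset.sum_range_succ,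
      Finset.sum_range_succ, ih, Finset.sum_range_succ (fun r => f (2 * r)) (M + 1),
      Finset.sum_range_succ (fun r => f (2 * r + 1)) M, show 2 * (M + 1) = 2 * M + 1 + 1 by ring]
    abel

lemma sum_range_succ_eq_sum_Icc {α : Type*} [AddCommMonoid α] {f : ℕ → α} {m : ℕ} (M : ℕ)
    (h : ∀ r < m, f r = 0) : ∑ r ∈ Finset.range (M + 1), f r = ∑ r ∈ Finset.Icc m M, f r := by
  symm
  refine Finset.sum_subset (fun r hr => ?_) fun r hr hr' => h r ?_
  · rw [Finset.mem_Icc] at hr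
    exact Finset.mem_range.2 (by omega)
  · rw [Finset.mem_range] at hr
    rw [Finset.mem_Icc] at hr'
    omega

lemma sum_range_shift_eq_sum_Icc {α : Type*} [AddCommMonoid α] {f : ℕ → α} {m : ℕ} (M : ℕ)
    (hm : 1 ≤ m) (h : ∀ r, 1 ≤ r → r < m → f r = 0) :
    ∑ r ∈ Finset.range M, f (r + 1) = ∑ r ∈ Finset.Icc m M, f r := by
  rw [Finset.range_eq_Ico, Finset.sum_Ico_add' f 0 M 1]
  symm
  refine Finset.sum_subset (fun r hr => ?_) fun r hr hr' => ?_
  · rw [Finset.mem_Icc] at hr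
    exact Finset.mem_Ico.2 (by omega)
  · rw [Finset.mem_Ico] at hr
    rw [Finset.mem_Icc] at hr'
    exact h r (by omega) (by omega)

/-- The power `(-i)^(j+1)` is imaginary for even `j` and real for odd `j`, so real parts enter in
order `2r+1` and imaginary parts in order `2r+2`. In the even orders `M` is real at both base points
`±1` and drops out. -/
lemma polylogSum_im {p q m : ℕ} (hpq : p + q = 2 * m) (T : ℝ) {L M : ℕ → ℂ}
    (hM : ∀ r, (M (2 * r + 2)).im = 0) :
    (polylogSum p q T L M).im =
      -(∑ r ∈ Finset.range (m + 1), T ^ (2 * m - 2 * r) / (2 * m - 2 * r).factorial *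
          (2 * (-1) ^ r) * ((-1) ^ p * (2 * r).choose p * (L (2 * r + 1)).re))
      + (∑ r ∈ Finset.range (m + 1), T ^ (2 * m - 2 * r) / (2 * m - 2 * r).factorial *
          (2 * (-1) ^ r) * ((-1) ^ q * (2 * r).choose q * (M (2 * r + 1)).re))
      + ∑ r ∈ Finset.range m, T ^ (2 * m - (2 * r + 1)) / (2 * m - (2 * r + 1)).factorial *
          (2 * (-1) ^ r) * ((-1) ^ p * (2 * r + 1).choose p * (L (2 * r + 2)).im) := by
  rw [polylogSum, hpq, sum_range_two_mul_add_one, Complex.add_im, Complex.im_sum, Complex.im_sum,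
    ← Finset.sum_neg_distrib, ← Finset.sum_add_distrib]
  have hI : ∀ r : ℕ, (-Complex.I) ^ (2 * r) = (-1) ^ r := fun r => by
    rw [pow_mul, neg_sq, Complex.I_sq]
  congr 1
  · refine Finset.sum_congr rfl fun r _ => ?_
    have e : (T : ℂ) ^ (2 * m - 2 * r) / ((2 * m - 2 * r).factorial : ℂ) *
        (2 * (-Complex.I) ^ (2 * r + 1)) *
        ((-1) ^ (2 * r + p) * ((2 * r).choose p : ℂ) * L (2 * r + 1) -
          (-1) ^ q * ((2 * r).choose q : ℂ) * M (2 * r + 1)) =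
        ((T ^ (2 * m - 2 * r) / (2 * m - 2 * r).factorial * (2 * (-1) ^ r) : ℝ) : ℂ) *
          (-Complex.I * ((((-1) ^ p * (2 * r).choose p : ℝ) : ℂ) * L (2 * r + 1) -
            (((-1) ^ q * (2 * r).choose q : ℝ) : ℂ) * M (2 * r + 1))) := by
      rw [pow_succ, hI, pow_add, pow_mul, neg_one_sq, one_pow]
      push_cast
      ring
    rw [e, Complex.im_ofReal_mul, neg_mul, Complex.neg_im, Complex.I_mul_im, Complex.sub_re,
      Complex.re_ofReal_mul, Complex.re_ofReal_mul]
    ring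
  · refine Finset.sum_congr rfl fun r _ => ?_
    have e : (T : ℂ) ^ (2 * m - (2 * r + 1)) / ((2 * m - (2 * r + 1)).factorial : ℂ) *
        (2 * (-Complex.I) ^ (2 * r + 1 + 1)) *
        ((-1) ^ (2 * r + 1 + p) * ((2 * r + 1).choose p : ℂ) * L (2 * r + 1 + 1) -
          (-1) ^ q * ((2 * r + 1).choose q : ℂ) * M (2 * r + 1 + 1)) =
        ((T ^ (2 * m - (2 * r + 1)) / (2 * m - (2 * r + 1)).factorial * (2 * (-1) ^ r) : ℝ) : ℂ) *
          ((((-1) ^ p * (2 * r + 1).choose p : ℝ) : ℂ) * L (2 * r + 2) +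
            (((-1) ^ q * (2 * r + 1).choose q : ℝ) : ℂ) * M (2 * r + 2)) := by
      rw [show 2 * r + 1 + 1 = 2 * (r + 1) by ring, hI, show 2 * r + 1 + p = 2 * r + (1 + p) by ring,
        pow_add _ (2 * r), pow_mul, neg_one_sq, one_pow, show 2 * (r + 1) = 2 * r + 2 by ring,
        pow_succ, pow_add]
      push_cast
      ring
    rw [e, Complex.im_ofReal_mul, Complex.add_im, Complex.im_ofReal_mul, Complex.im_ofReal_mul, hM]
    ring

lemma polylogBoundary_of_ne_one {s : ℕ} (hs : s ≠ 1) (w : ℂ) :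
    polylogBoundary s w = polylog s w := if_neg hs

lemma riemannZeta_two_mul_add_one {r : ℕ} (hr : 1 ≤ r) :
    riemannZeta (2 * (r : ℂ) + 1) = ((realDirichlet (fun _ => 1) (2 * r + 1) : ℝ) : ℂ) := by
  rw [← riemannZeta_eq_realDirichlet (by omega)]
  push_cast
  rfl

lemma LFunction_two_mul {χ : DirichletCharacter ℂ 3} (hχ : χ ≠ 1) {r : ℕ} (hr : 1 ≤ r) :
    DirichletCharacter.LFunction χ (2 * (r : ℂ)) =
      ((realDirichlet chiThree (2 * r) : ℝ) : ℂ) := by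
  rw [← LFunction_eq_realDirichlet hχ (by omega)]
  push_cast
  rfl

lemma zpow_neg_two_mul (x : ℂ) (r : ℕ) : x ^ (-(2 * (r : ℤ))) = (x ^ (2 * r))⁻¹ := by
  rw [zpow_neg]
  exact_mod_cast rfl

lemma two_zpow_one_sub (r : ℕ) : (2 : ℂ) ^ (1 - 2 * (r : ℤ)) = 2 / 2 ^ (2 * r) := by
  rw [zpow_sub₀ two_ne_zero, zpow_one]
  exact_mod_cast rfl

theorem aperySum_one_eq {χ : DirichletCharacter ℂ 3} (hχ : χ ≠ 1) {a b k : ℕ} (ha : 1 ≤ a)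
    (hk : k = 2 * a + 2 * b + 1) :
    ((aperySum (twosAround a 1 b) : ℝ) : ℂ) =
        (∑ r ∈ Finset.Icc a (a + b),
          ((2 * r).choose (2 * a - 1) : ℂ) *
            (((Real.pi : ℂ) / 3) ^ (k - 1 - 2 * r) / ((k - 1 - 2 * r).factorial : ℂ)) *
            (-1) ^ r * (1 - (3 : ℂ) ^ (-(2 * (r : ℤ)))) * riemannZeta (2 * (r : ℂ) + 1))
        + (∑ r ∈ Finset.Icc a (a + b),
          ((2 * r - 1).choose (2 * a - 1) : ℂ) *
            (((Real.pi : ℂ) / 3) ^ (k - 2 * r) / ((k - 2 * r).factorial : ℂ)) *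
            (-1) ^ r * ((Real.sqrt 3 : ℝ) : ℂ) * DirichletCharacter.LFunction χ (2 * (r : ℂ)))
        - (∑ r ∈ Finset.Icc (b + 1) (a + b),
          ((2 * r).choose (2 * b + 1) : ℂ) *
            (((Real.pi : ℂ) / 3) ^ (k - 1 - 2 * r) / ((k - 1 - 2 * r).factorial : ℂ)) *
            (-1) ^ r * (2 * (1 - (2 : ℂ) ^ (-(2 * (r : ℤ))))) *
            riemannZeta (2 * (r : ℂ) + 1)) := by
  obtain ⟨a, rfl⟩ := Nat.exists_eq_add_of_le' ha
  have hp : 2 * (a + 1) - 1 = 2 * a + 1 := by omega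
  rw [(aperySum_twosAround_one a b).2, integral_betaKernel_mul_tan (by omega),
    polylogSum_im (m := a + 1 + b) (by ring) _ (fun r => by
      rw [polylogBoundary_of_ne_one (by omega), polylog_neg_one (by omega), Complex.ofReal_im]),
    hp]
  have c1 : ∀ r < a + 1, (2 * r).choose (2 * a + 1) = 0 := fun r hr =>
    Nat.choose_eq_zero_of_lt (by omega)
  have c2 : ∀ r < b + 1, (2 * r).choose (2 * b + 1) = 0 := fun r hr =>
    Nat.choose_eq_zero_of_lt (by omega)
  have c3 : ∀ r, 1 ≤ r → r < a + 1 → (2 * r - 1).choose (2 * a + 1) = 0 := fun r _ hr =>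
    Nat.choose_eq_zero_of_lt (by omega)
  rw [sum_range_succ_eq_sum_Icc (m := a + 1) (a + 1 + b) (fun r hr => by simp [c1 r hr]),
    sum_range_succ_eq_sum_Icc (m := b + 1) (a + 1 + b) (fun r hr => by simp [c2 r hr])]
  -- The even orders appear as `2r+2` with `r` from 0, while the target sum runs over `L(2r, χ)`;
  -- the shift turns the sign into `(-1)^(r-1)`.
  have hshift := sum_range_shift_eq_sum_Icc (m := a + 1) (f := fun r =>
    (Real.pi / 3) ^ (k - 2 * r) / (k - 2 * r).factorial * (2 * (-1) ^ (r - 1)) *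
      ((-1) ^ (2 * a + 1) * (2 * r - 1).choose (2 * a + 1) *
        (polylogBoundary (2 * r) (-Complex.exp ((Real.pi / 3 : ℝ) * Complex.I))).im))
    (a + 1 + b) (by omega) (fun r h1 h2 => by simp [c3 r h1 h2])
  have hsum : ∀ r, (Real.pi / 3) ^ (2 * (a + 1 + b) - (2 * r + 1)) /
      (2 * (a + 1 + b) - (2 * r + 1)).factorial * (2 * (-1) ^ r) *
      ((-1) ^ (2 * a + 1) * (2 * r + 1).choose (2 * a + 1) *
        (polylogBoundary (2 * r + 2) (-Complex.exp ((Real.pi / 3 : ℝ) * Complex.I))).im) =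
      (Real.pi / 3) ^ (k - 2 * (r + 1)) / (k - 2 * (r + 1)).factorial * (2 * (-1) ^ (r + 1 - 1)) *
      ((-1) ^ (2 * a + 1) * (2 * (r + 1) - 1).choose (2 * a + 1) *
        (polylogBoundary (2 * (r + 1)) (-Complex.exp ((Real.pi / 3 : ℝ) * Complex.I))).im) := by
    intro r
    rw [show 2 * (a + 1 + b) - (2 * r + 1) = k - 2 * (r + 1) by omega,
      show r + 1 - 1 = r by omega, show 2 * (r + 1) - 1 = 2 * r + 1 by omega,
      show 2 * (r + 1) = 2 * r + 2 by ring]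
  simp_rw [hsum]
  rw [hshift, neg_add, neg_add, neg_neg, ← Finset.sum_neg_distrib, ← Finset.sum_neg_distrib]
  have hre := fun s (hs : 2 ≤ s) => polylog_neg_exp_re hs
  have him := fun s (hs : 2 ≤ s) => polylog_neg_exp_im hs
  clear hsum hshift
  generalize -Complex.exp ((Real.pi / 3 : ℝ) * Complex.I) = w at hre him ⊢
  push_cast
  rw [sub_eq_add_neg, ← Finset.sum_neg_distrib, add_right_comm]
  have odd : ∀ c : ℕ, (-1 : ℂ) ^ (2 * c + 1) = -1 := fun c => by
    rw [pow_succ, pow_mul, neg_one_sq, one_pow, one_mul]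
  congr 1
  · congr 1
    · refine Finset.sum_congr rfl fun r hr => ?_
      have hr1 : 1 ≤ r := by have := (Finset.mem_Icc.1 hr).1; omega
      -- In order `s = 2r+1` the factor `1 - 3/3^s` is `1 - 3^(-2r)`; the prefactor 2, the sign
      -- `(-1)^p = -1` and the `-1/2` of the real part cancel.
      rw [show k - 1 - 2 * r = 2 * (a + 1 + b) - 2 * r by omega,
        polylogBoundary_of_ne_one (by omega), hre _ (by omega),
        riemannZeta_two_mul_add_one hr1, zpow_neg_two_mul, odd, pow_succ (3 : ℝ)]
      push_cast
      field_simp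
    · refine Finset.sum_congr rfl fun r hr => ?_
      have hr1 : 1 ≤ r := by have := (Finset.mem_Icc.1 hr).1; omega
      obtain ⟨r, rfl⟩ := Nat.exists_eq_add_of_le' hr1
      rw [polylogBoundary_of_ne_one (by omega), him _ (by omega),
        LFunction_two_mul hχ hr1, odd, pow_succ (-1 : ℂ) r, Nat.add_sub_cancel]
      push_cast
      ring
  · refine Finset.sum_congr rfl fun r hr => ?_
    have hr1 : 1 ≤ r := by have := (Finset.mem_Icc.1 hr).1; omega
    rw [show k - 1 - 2 * r = 2 * (a + 1 + b) - 2 * r by omega,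
      polylogBoundary_of_ne_one (by omega), polylog_neg_one (by omega), Complex.ofReal_re,
      riemannZeta_two_mul_add_one hr1, zpow_neg_two_mul, odd, pow_succ (2 : ℝ)]
    push_cast
    field_simp
    ring

theorem aperySum_three_eq {χ : DirichletCharacter ℂ 3} (hχ : χ ≠ 1) {a b k : ℕ}
    (hk : k = 2 * a + 2 * b + 3) :
    ((aperySum (twosAround a 3 b) : ℝ) : ℂ) =
        -(∑ r ∈ Finset.Icc (max a 1) (a + b + 1),
          ((2 * r).choose (2 * a) : ℂ) *
            (((Real.pi : ℂ) / 3) ^ (k - 1 - 2 * r) / ((k - 1 - 2 * r).factorial : ℂ)) *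
            (-1) ^ r * (1 - (2 : ℂ) ^ (-(2 * (r : ℤ)))) * (1 - (3 : ℂ) ^ (-(2 * (r : ℤ)))) *
            riemannZeta (2 * (r : ℂ) + 1))
        - (∑ r ∈ Finset.Icc (a + 1) (a + b + 1),
          ((2 * r - 1).choose (2 * a) : ℂ) *
            (((Real.pi : ℂ) / 3) ^ (k - 2 * r) / ((k - 2 * r).factorial : ℂ)) *
            (-1) ^ r * ((Real.sqrt 3 : ℝ) : ℂ) * (1 + (2 : ℂ) ^ (1 - 2 * (r : ℤ))) *
            DirichletCharacter.LFunction χ (2 * (r : ℂ)))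
        + (∑ r ∈ Finset.Icc (b + 1) (a + b + 1),
          ((2 * r).choose (2 * b + 2) : ℂ) *
            (((Real.pi : ℂ) / 3) ^ (k - 1 - 2 * r) / ((k - 1 - 2 * r).factorial : ℂ)) *
            (2 * (-1) ^ r) * riemannZeta (2 * (r : ℂ) + 1)) := by
  rw [(aperySum_twosAround_three a b).2, integral_betaKernel_mul_cot _ (by omega),
    polylogSum_im (m := a + b + 1) (by ring) _ (fun r => by
      rw [polylogBoundary_of_ne_one (by omega), polylog_one, Complex.ofReal_im])]
  have c2 : ∀ r < b + 1, (2 * r).choose (2 * b + 2) = 0 := fun r hr =>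
    Nat.choose_eq_zero_of_lt (by omega)
  have c3 : ∀ r, 1 ≤ r → r < a + 1 → (2 * r - 1).choose (2 * a) = 0 := fun r _ hr =>
    Nat.choose_eq_zero_of_lt (by omega)
  -- For `r = 0` the order-1 polylogarithm has real part zero, which covers `a = 0`; for `0 < r < a`
  -- the binomial coefficient vanishes.
  rw [sum_range_succ_eq_sum_Icc (m := max a 1) (a + b + 1) (fun r hr => by
      rcases Nat.eq_zero_or_pos r with rfl | h0
      · have : polylogBoundary (2 * 0 + 1) (Complex.exp ((Real.pi / 3 : ℝ) * Complex.I)) =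
          -Complex.log (1 - Complex.exp ((Real.pi / 3 : ℝ) * Complex.I)) := if_pos rfl
        rw [this, log_one_sub_exp_re]
        simp
      · simp [Nat.choose_eq_zero_of_lt (show 2 * r < 2 * a by
          rcases lt_max_iff.1 hr with h | h <;> omega)]),
    sum_range_succ_eq_sum_Icc (m := b + 1) (a + b + 1) (fun r hr => by simp [c2 r hr])]
  have hshift := sum_range_shift_eq_sum_Icc (m := a + 1) (f := fun r =>
    (Real.pi / 3) ^ (k - 2 * r) / (k - 2 * r).factorial * (2 * (-1) ^ (r - 1)) *
      ((-1) ^ (2 * a) * (2 * r - 1).choose (2 * a) *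
        (polylogBoundary (2 * r) (Complex.exp ((Real.pi / 3 : ℝ) * Complex.I))).im))
    (a + b + 1) (by omega) (fun r h1 h2 => by simp [c3 r h1 h2])
  have hsum : ∀ r, (Real.pi / 3) ^ (2 * (a + b + 1) - (2 * r + 1)) /
      (2 * (a + b + 1) - (2 * r + 1)).factorial * (2 * (-1) ^ r) *
      ((-1) ^ (2 * a) * (2 * r + 1).choose (2 * a) *
        (polylogBoundary (2 * r + 2) (Complex.exp ((Real.pi / 3 : ℝ) * Complex.I))).im) =
      (Real.pi / 3) ^ (k - 2 * (r + 1)) / (k - 2 * (r + 1)).factorial * (2 * (-1) ^ (r + 1 - 1)) *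
      ((-1) ^ (2 * a) * (2 * (r + 1) - 1).choose (2 * a) *
        (polylogBoundary (2 * (r + 1)) (Complex.exp ((Real.pi / 3 : ℝ) * Complex.I))).im) := by
    intro r
    rw [show 2 * (a + b + 1) - (2 * r + 1) = k - 2 * (r + 1) by omega,
      show r + 1 - 1 = r by omega, show 2 * (r + 1) - 1 = 2 * r + 1 by omega,
      show 2 * (r + 1) = 2 * r + 2 by ring]
  simp_rw [hsum]
  rw [hshift]
  have hre := fun s (hs : 2 ≤ s) => polylog_exp_re hs
  have him := fun s (hs : 2 ≤ s) => polylog_exp_im hs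
  clear hsum hshift
  generalize Complex.exp ((Real.pi / 3 : ℝ) * Complex.I) = w at hre him ⊢
  push_cast
  rw [add_right_comm, sub_eq_add_neg, ← Finset.sum_neg_distrib, ← Finset.sum_neg_distrib,
    ← Finset.sum_neg_distrib]
  have even : ∀ c : ℕ, (-1 : ℂ) ^ (2 * c) = 1 := fun c => by rw [pow_mul, neg_one_sq, one_pow]
  congr 1
  · congr 1
    · refine Finset.sum_congr rfl fun r hr => ?_
      have hr1 : 1 ≤ r := (le_max_right _ _).trans (Finset.mem_Icc.1 hr).1
      rw [show k - 1 - 2 * r = 2 * (a + b + 1) - 2 * r by omega,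
        polylogBoundary_of_ne_one (by omega), hre _ (by omega),
        riemannZeta_two_mul_add_one hr1, zpow_neg_two_mul, zpow_neg_two_mul, even,
        pow_succ (3 : ℝ), pow_succ (2 : ℝ)]
      push_cast
      field_simp
    · refine Finset.sum_congr rfl fun r hr => ?_
      have hr1 : 1 ≤ r := by have := (Finset.mem_Icc.1 hr).1; omega
      rw [two_zpow_one_sub]
      obtain ⟨r, rfl⟩ := Nat.exists_eq_add_of_le' hr1
      rw [polylogBoundary_of_ne_one (by omega), him _ (by omega),
        LFunction_two_mul hχ hr1, even, pow_succ (-1 : ℂ) r, Nat.add_sub_cancel]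
      push_cast
      ring
  · refine Finset.sum_congr rfl fun r hr => ?_
    have hr1 : 1 ≤ r := by have := (Finset.mem_Icc.1 hr).1; omega
    rw [show k - 1 - 2 * r = 2 * (a + b + 1) - 2 * r by omega,
      polylogBoundary_of_ne_one (by omega), polylog_one, Complex.ofReal_re,
      riemannZeta_two_mul_add_one hr1, show 2 * b + 2 = 2 * (b + 1) by ring, even]
    ring

theorem mainTheorem8 (χ : DirichletCharacter ℂ 3) (hχ : χ ≠ 1) :
    (∀ a b k : ℕ, 1 ≤ a → k = 2 * a + 2 * b + 1 →
      AperySummable (twosAround a 1 b) ∧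
      ((aperySum (twosAround a 1 b) : ℝ) : ℂ) =
        (∑ r ∈ Finset.Icc a (a + b),
          ((2 * r).choose (2 * a - 1) : ℂ) *
            (((Real.pi : ℂ) / 3) ^ (k - 1 - 2 * r) / ((k - 1 - 2 * r).factorial : ℂ)) *
            (-1) ^ r * (1 - (3 : ℂ) ^ (-(2 * (r : ℤ)))) * riemannZeta (2 * (r : ℂ) + 1))
        + (∑ r ∈ Finset.Icc a (a + b),
          ((2 * r - 1).choose (2 * a - 1) : ℂ) *
            (((Real.pi : ℂ) / 3) ^ (k - 2 * r) / ((k - 2 * r).factorial : ℂ)) *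
            (-1) ^ r * ((Real.sqrt 3 : ℝ) : ℂ) * DirichletCharacter.LFunction χ (2 * (r : ℂ)))
        - (∑ r ∈ Finset.Icc (b + 1) (a + b),
          ((2 * r).choose (2 * b + 1) : ℂ) *
            (((Real.pi : ℂ) / 3) ^ (k - 1 - 2 * r) / ((k - 1 - 2 * r).factorial : ℂ)) *
            (-1) ^ r * (2 * (1 - (2 : ℂ) ^ (-(2 * (r : ℤ))))) *
            riemannZeta (2 * (r : ℂ) + 1))) ∧
    (∀ a b k : ℕ, k = 2 * a + 2 * b + 3 →
      AperySummable (twosAround a 3 b) ∧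
      ((aperySum (twosAround a 3 b) : ℝ) : ℂ) =
        -(∑ r ∈ Finset.Icc (max a 1) (a + b + 1),
          ((2 * r).choose (2 * a) : ℂ) *
            (((Real.pi : ℂ) / 3) ^ (k - 1 - 2 * r) / ((k - 1 - 2 * r).factorial : ℂ)) *
            (-1) ^ r * (1 - (2 : ℂ) ^ (-(2 * (r : ℤ)))) * (1 - (3 : ℂ) ^ (-(2 * (r : ℤ)))) *
            riemannZeta (2 * (r : ℂ) + 1))
        - (∑ r ∈ Finset.Icc (a + 1) (a + b + 1),
          ((2 * r - 1).choose (2 * a) : ℂ) *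
            (((Real.pi : ℂ) / 3) ^ (k - 2 * r) / ((k - 2 * r).factorial : ℂ)) *
            (-1) ^ r * ((Real.sqrt 3 : ℝ) : ℂ) * (1 + (2 : ℂ) ^ (1 - 2 * (r : ℤ))) *
            DirichletCharacter.LFunction χ (2 * (r : ℂ)))
        + (∑ r ∈ Finset.Icc (b + 1) (a + b + 1),
          ((2 * r).choose (2 * b + 2) : ℂ) *
            (((Real.pi : ℂ) / 3) ^ (k - 1 - 2 * r) / ((k - 1 - 2 * r).factorial : ℂ)) *
            (2 * (-1) ^ r) * riemannZeta (2 * (r : ℂ) + 1))) := 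
  ⟨fun _ b _ ha hk => ⟨by
      obtain ⟨a, rfl⟩ := Nat.exists_eq_add_of_le' ha
      exact (aperySum_twosAround_one a b).1, aperySum_one_eq hχ ha hk⟩,
    fun a b _ hk => ⟨(aperySum_twosAround_three a b).1, aperySum_three_eq hχ hk⟩⟩
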